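/- Let ${\bf H}^2_{\mathbb C}$ be the complex hyperbolic plane with its ${\rm PU}(2,1)$-invariant metric normalized to have holomorphic sectional curvature $-1$ (so complex lines have curvature $-1$). Let $\Gamma$ be a discrete subgroup of ${\rm PU}(2,1)$ containing a complex reflection $A$ of order $n\ge 7$ that fixes pointwise a complex line $m_A\subset{\bf H}^2_{\mathbb C}$, its mirror. (A complex reflection is a non-trivial element having a matrix representative in ${\rm U}(2,1)$ that is diagonalizable with an eigenvalue of multiplicity $2$; its mirror is the projectivization of the corresponding eigenspace, intersected with ${\bf H}^2_{\mathbb C}$.) Let $\Gamma_A=\{g\in\Gamma : g(m_A)=m_A\}$ be the stabilizer of $m_A$ in $\Gamma$. Then $$ {\rm Vol}(\Gamma\backslash{\bf H}^2_{\mathbb C})\ \ge\ \frac{\pi\left(1-2\sin\frac{\pi}{n}\right)}{2n\sin\frac{\pi}{n}}\,{\rm Vol}(m_A/\Gamma_A). $$ Moreover, if there is no $g\in\Gamma$ such that $g(m_A)$ is orthogonal to $m_A$, then $$ {\rm Vol}(\Gamma\backslash{\bf H}^2_{\mathbb C})\ \ge\ \frac{\pi\left(1-2\sin\frac{\pi}{n}\right)}{n\sin\frac{\pi}{n}}\,{\rm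 Vol}(m_A/\Gamma_A). $$ Here ${\rm Vol}(\Gamma\backslash{\bf H}^2_{\mathbb C})\in[0,\infty]$ is the Riemannian volume of a fundamental domain for $\Gamma$ in ${\bf H}^2_{\mathbb C}$, and ${\rm Vol}(m_A/\Gamma_A)\in[0,\infty]$ is the area, for the induced metric, of a fundamental domain in $m_A$ for the group of transformations of $m_A$ induced by $\Gamma_A$. Two complex lines are orthogonal if their polar vectors are orthogonal for the Hermitian form of signature $(2,1)$. -/

import Mathlib

open scoped Pointwise ENNReal

noncomputable section

namespace ComplexHyperbolic

/-- The standard Hermitian form of signature `(2,1)` on `ℂ³`. -/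
def herm (x y : Fin 3 → ℂ) : ℂ :=
  x 0 * starRingEnd ℂ (y 0) + x 1 * starRingEnd ℂ (y 1) - x 2 * starRingEnd ℂ (y 2)

/-- The complex hyperbolic plane, in the ball model. -/
abbrev H2 : Type := {z : ℂ × ℂ // Complex.normSq z.1 + Complex.normSq z.2 < 1}

/-- The standard lift of a point of the affine chart `ℂ²` to `ℂ³`. -/
def lift (z : ℂ × ℂ) : Fin 3 → ℂ := ![z.1, z.2, 1]

/-- The point of the affine chart `ℂ²` represented by a vector of `ℂ³`. -/
def dehom (y : Fin 3 → ℂ) : ℂ × ℂ := (y 0 / y 2, y 1 / y 2)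

/-! ### The group `PU(2,1)` and its action on the ball -/

/-- The unitary group `U(2,1)` of the Hermitian form. -/
def U21 : Subgroup (GL (Fin 3) ℂ) where
  carrier := {g | ∀ x y, herm (g.val.mulVec x) (g.val.mulVec y) = herm x y}
  one_mem' := by intro x y; simp
  mul_mem' := by
    intro a b ha hb x y
    have h := ha (b.val.mulVec x) (b.val.mulVec y)
    rw [Matrix.mulVec_mulVec, Matrix.mulVec_mulVec] at h
    exact h.trans (hb x y)
  inv_mem' := by
    intro a ha x y
    have h := ha (a⁻¹.val.mulVec x) (a⁻¹.val.mulVec y)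
    rw [Matrix.mulVec_mulVec, Matrix.mulVec_mulVec, ← Units.val_mul, mul_inv_cancel] at h
    simpa using h.symm

/-- The subgroup of scalar matrices in `U(2,1)`. -/
def scalars : Subgroup U21 where
  carrier := {g | ∃ a : ℂ, ∀ x, g.val.val.mulVec x = a • x}
  one_mem' := ⟨1, by intro x; simp⟩
  mul_mem' := by
    rintro g h ⟨a, ha⟩ ⟨b, hb⟩
    refine ⟨a * b, fun x => ?_⟩
    have : (g * h).val.val.mulVec x = g.val.val.mulVec (h.val.val.mulVec x) := by
      rw [Matrix.mulVec_mulVec]; rfl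
    rw [this, hb, ha, smul_smul]
  inv_mem' := by
    rintro g ⟨a, ha⟩
    have key : ∀ x, a • (g⁻¹).val.val.mulVec x = x := by
      intro x
      rw [← ha, Matrix.mulVec_mulVec]
      have : g.val.val * (g⁻¹).val.val = 1 := by
        rw [← Units.val_mul, ← Subgroup.coe_mul, mul_inv_cancel]; rfl
      rw [this, Matrix.one_mulVec]
    have ha0 : a ≠ 0 := by
      rintro rfl
      have := congrFun (key (fun _ => 1)) 0
      simp at this
    refine ⟨a⁻¹, fun x => ?_⟩
    conv_rhs => rw [← key x]
    rw [smul_smul, inv_mul_cancel₀ ha0, one_smul]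

instance : scalars.Normal where
  conj_mem := by
    rintro n ⟨a, ha⟩ g
    refine ⟨a, fun x => ?_⟩
    have h1 : (g * n * g⁻¹).val.val.mulVec x
        = g.val.val.mulVec (n.val.val.mulVec ((g⁻¹).val.val.mulVec x)) := by
      rw [Matrix.mulVec_mulVec, Matrix.mulVec_mulVec]
      rfl
    have h2 : g.val.val * (g⁻¹).val.val = 1 := by
      rw [← Units.val_mul, ← Subgroup.coe_mul, mul_inv_cancel]; rfl
    rw [h1, ha, Matrix.mulVec_smul, Matrix.mulVec_mulVec, h2, Matrix.one_mulVec]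

/-- The projective unitary group `PU(2,1)`, with the quotient topology. -/
abbrev PU21 : Type := U21 ⧸ scalars

theorem dehom_smul {a : ℂ} (ha : a ≠ 0) (y : Fin 3 → ℂ) : dehom (a • y) = dehom y := by
  simp [dehom, mul_div_mul_left _ _ ha]

theorem dehom_lift (z : ℂ × ℂ) : dehom (lift z) = z := by simp [dehom, lift]

theorem lift_dehom {y : Fin 3 → ℂ} (hy : y 2 ≠ 0) : lift (dehom y) = (y 2)⁻¹ • y := by
  ext i
  fin_cases i <;> simp [dehom, lift, hy, div_eq_inv_mul]

theorem herm_self_re (y : Fin 3 → ℂ) :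
    (herm y y).re = Complex.normSq (y 0) + Complex.normSq (y 1) - Complex.normSq (y 2) := by
  simp [herm, Complex.mul_conj]

theorem coord_ne_zero {y : Fin 3 → ℂ} (hy : (herm y y).re < 0) : y 2 ≠ 0 := by
  intro h
  rw [herm_self_re, h, map_zero] at hy
  linarith [Complex.normSq_nonneg (y 0), Complex.normSq_nonneg (y 1)]

theorem dehom_mem {y : Fin 3 → ℂ} (hy : (herm y y).re < 0) :
    Complex.normSq (dehom y).1 + Complex.normSq (dehom y).2 < 1 := by
  have h2 := Complex.normSq_pos.2 (coord_ne_zero hy)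
  rw [herm_self_re] at hy
  simp only [dehom, Complex.normSq_div]
  rw [← add_div, div_lt_one h2]
  linarith

theorem herm_image_neg (g : U21) (z : H2) :
    (herm (g.val.val.mulVec (lift z.1)) (g.val.val.mulVec (lift z.1))).re < 0 := by
  have hz := z.2
  rw [g.2, herm_self_re]
  simp [lift]
  linarith

/-- The action of `U(2,1)` on the ball by fractional linear transformations. -/
instance : MulAction U21 H2 where
  smul g z := ⟨dehom (g.val.val.mulVec (lift z.1)), dehom_mem (herm_image_neg g z)⟩
  one_smul z := by
    apply Subtype.ext
    change dehom ((1 : Matrix (Fin 3) (Fin 3) ℂ).mulVec (lift z.1)) = z.1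
    rw [Matrix.one_mulVec, dehom_lift]
  mul_smul g h z := by
    apply Subtype.ext
    have h0 := coord_ne_zero (herm_image_neg h z)
    change dehom ((g.val.val * h.val.val).mulVec (lift z.1))
      = dehom (g.val.val.mulVec (lift (dehom (h.val.val.mulVec (lift z.1)))))
    rw [lift_dehom h0, Matrix.mulVec_smul, dehom_smul (inv_ne_zero h0), Matrix.mulVec_mulVec]

theorem coe_smul (g : U21) (z : H2) :
    (g • z).1 = dehom (g.val.val.mulVec (lift z.1)) := rfl

theorem scalars_le_ker : scalars ≤ (MulAction.toPermHom U21 H2).ker := by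
  rintro g ⟨a, ha⟩
  rw [MonoidHom.mem_ker]
  ext1 z
  apply Subtype.ext
  change (g • z).1 = z.1
  have h0 := coord_ne_zero (herm_image_neg g z)
  rw [ha] at h0
  have ha0 : a ≠ 0 := by
    rintro rfl
    simp at h0
  rw [coe_smul, ha, dehom_smul ha0, dehom_lift]

/-- The action of `PU(2,1)` on the ball induced by that of `U(2,1)`. -/
instance : MulAction PU21 H2 :=
  MulAction.compHom H2 (QuotientGroup.lift scalars (MulAction.toPermHom U21 H2) scalars_le_ker)

theorem mk_smul (g : U21) (z : H2) : (QuotientGroup.mk g : PU21) • z = g • z := rfl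

/-! ### The complex hyperbolic metric and its volume and area measures -/

/-- The complex hyperbolic metric on the ball, with holomorphic sectional curvature `-1`: for
tangent vectors `v, w` at `z`, with `Z = (z,1)`, `V = (v,0)`, `W = (w,0)`, it is the real part of
`-4 (⟨Z,Z⟩⟨V,W⟩ - ⟨V,Z⟩⟨Z,W⟩) / ⟨Z,Z⟩²`. -/
def metric (z v w : ℂ × ℂ) : ℝ :=
  -4 * (herm (lift z) (lift z) * herm ![v.1, v.2, 0] ![w.1, w.2, 0]
      - herm ![v.1, v.2, 0] (lift z) * herm (lift z) ![w.1, w.2, 0]).re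
    / (herm (lift z) (lift z)).re ^ 2

/-- The `k`-dimensional Riemannian volume of the parallelotope spanned by `k` tangent vectors. -/
def gramDensity {k : ℕ} (z : ℂ × ℂ) (X : Fin k → ℂ × ℂ) : ℝ :=
  Real.sqrt (Matrix.det (Matrix.of fun i j => metric z (X i) (X j)))

/-- The Riemannian volume measure of the complex hyperbolic plane (the four vectors are the
standard real basis of `ℂ²`). -/
def hypVolume : MeasureTheory.Measure H2 :=
  MeasureTheory.Measure.comap Subtype.val
    ((MeasureTheory.volume : MeasureTheory.Measure (ℂ × ℂ)).withDensity fun z =>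
      ENNReal.ofReal (gramDensity z ![(1, 0), (Complex.I, 0), (0, 1), (0, Complex.I)]))

/-- The points of the complex hyperbolic plane orthogonal to `c`. It is a complex line
(a complex totally geodesic curve) when `c` is a positive vector, i.e. `⟨c,c⟩ > 0`; then `c` is
called polar to it. -/
def complexLine (c : Fin 3 → ℂ) : Set H2 := {z | herm (lift z.1) c = 0}

/-- The direction of the affine complex line `{z ∈ ℂ² : ⟨(z,1),c⟩ = 0}`. -/
def lineDir (c : Fin 3 → ℂ) : ℂ × ℂ := (-starRingEnd ℂ (c 1), starRingEnd ℂ (c 0))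

/-- An affine parametrization of the affine complex line `{z ∈ ℂ² : ⟨(z,1),c⟩ = 0}`. -/
def linePoint (c : Fin 3 → ℂ) (w : ℂ) : ℂ × ℂ :=
  (starRingEnd ℂ (c 2) / (Complex.normSq (c 0) + Complex.normSq (c 1))) • (c 0, c 1)
    + w • lineDir c

/-- The Riemannian area measure on a complex line, for the induced metric: the density of the area
in the parameter `w` is the area of the parallelogram spanned by the images of `1` and `i`. -/
def lineArea (c : Fin 3 → ℂ) : MeasureTheory.Measure (complexLine c) :=
  MeasureTheory.Measure.comap (fun x => x.1.1)
    (MeasureTheory.Measure.map (linePoint c)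
      ((MeasureTheory.volume : MeasureTheory.Measure ℂ).withDensity fun w =>
        ENNReal.ofReal (gramDensity (linePoint c w) ![lineDir c, Complex.I • lineDir c])))

/-- The volume of the quotient of `X` by a group of measure preserving transformations: the measure
of a fundamental domain. The action is replaced by the effective action of the image of `G` in the
group of permutations of `X`, since a part of `G` may act trivially. -/
def quotientVolume (G X : Type*) [Group G] [MulAction G X] [MeasurableSpace X]
    (μ : MeasureTheory.Measure X) : ℝ≥0∞ :=
  MeasureTheory.covolume (MulAction.toPermHom G X).range X μ

/-! ### Complex reflections and orthogonality -/

/-- `A` is a complex reflection whose mirror is the complex line polar to `c`: it has a matrix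
representative that is not scalar, acts on the orthogonal complement of `c` by a scalar `a`
(so that `a` is an eigenvalue of multiplicity two) and has `c` as an eigenvector. -/
def IsComplexReflection (A : PU21) (c : Fin 3 → ℂ) : Prop :=
  0 < (herm c c).re ∧ ∃ g : U21, (QuotientGroup.mk g : PU21) = A ∧
    ∃ a b : ℂ, a ≠ b ∧ (∀ x, herm x c = 0 → g.val.val.mulVec x = a • x) ∧
      g.val.val.mulVec c = b • c

/-- Two complex lines are orthogonal if they have orthogonal polar vectors. -/
def OrthogonalLines (L M : Set H2) : Prop :=
  ∃ c d : Fin 3 → ℂ, 0 < (herm c c).re ∧ 0 < (herm d d).re ∧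
    L = complexLine c ∧ M = complexLine d ∧ herm c d = 0

end ComplexHyperbolic

end

noncomputable section

namespace ComplexHyperbolic

open Matrix Filter Topology MeasureTheory

/-! The proof packs tubes around the images of the mirror. Let `N` be the order of the finite cyclic
group of all reflections in `Γ` about the mirror polar to `c`. Then `N ≥ n`, and `Γ` contains the
rotation by `2π/N` about the mirror, whose factor `ζ` satisfies `‖ζ - 1‖ = 2 sin(π/N) < 1`.

A Jørgensen argument (`jorgensen_inequality`) shows that an image `g c` of the polar vector is
proportional to `c`, orthogonal to `c`, or satisfies `|⟨gc,c⟩| / ⟨c,c⟩ ≥ 1/(2 sin(π/N))`. Otherwise,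
iterated conjugation of the reflection would give pairwise distinct polar directions converging to
that of `c`, against discreteness. If the tubes `sinh²(ρ/2) < S` around two lines of the orbit have
a common point, then `|⟨c,d⟩| < (1 + 2S)⟨c,c⟩` (`norm_herm_lt_of_mem_tube`). Hence, when `2
sin(π/N)(1 + 2S) ≤ 1`, tubes around distinct lines meet only if the lines are orthogonal. Signature
`(2,1)` admits no three pairwise orthogonal positive vectors (`not_three_orthogonal`), so a point
lies in at most `m` tubes, with `m = 2` in general and `m = 1` without orthogonal images.

Now take the part of the tube over a fundamental domain of the mirror. Each of the at most `m` lines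
accounts for at most `N` elements of `Γ`, so every orbit is met at most `mN` times, and the volume
of this piece is at most `mN` times the covolume (`measure_le_of_encard_returnSet_le`). An explicit
integration in coordinates adapted to the line (`hypVolume_tubeOver`) gives its volume as `2π((1 +
S)² - 1)` times the area of its base. The choice `(1 + S)² = 1/(2 sin(π/N))` is admissible because
`1 + 2S ≤ (1 + S)²`, and it yields the stated constant with `N` in place of `n`. This constant
increases with `N` (`volume_constant_mono`), so `N` may be replaced by `n`.

Since covolumes are defined through fundamental domains, one has to be constructed in the ball
(`exists_isFundamentalDomain`). This uses proper discontinuity and the fact that fixed-point sets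
are null. -/

/-! ### Algebra of the Hermitian form -/

theorem herm_add_left (x y z : Fin 3 → ℂ) : herm (x + y) z = herm x z + herm y z := by
  simp [herm]; ring

theorem herm_sub_left (x y z : Fin 3 → ℂ) : herm (x - y) z = herm x z - herm y z := by
  simp [herm]; ring

theorem herm_smul_left (a : ℂ) (x z : Fin 3 → ℂ) : herm (a • x) z = a * herm x z := by
  simp [herm]; ring

theorem conj_herm (x y : Fin 3 → ℂ) : starRingEnd ℂ (herm x y) = herm y x := by
  simp [herm]; ring

theorem herm_add_right (x y z : Fin 3 → ℂ) : herm z (x + y) = herm z x + herm z y := by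
  simp [herm]; ring

theorem herm_sub_right (x y z : Fin 3 → ℂ) : herm z (x - y) = herm z x - herm z y := by
  simp [herm]; ring

theorem herm_smul_right (a : ℂ) (x z : Fin 3 → ℂ) :
    herm z (a • x) = starRingEnd ℂ a * herm z x := by
  simp [herm]; ring

theorem herm_eq_zero_comm {x y : Fin 3 → ℂ} : herm x y = 0 ↔ herm y x = 0 := by
  rw [← conj_herm x y, map_eq_zero]

theorem norm_herm_comm (x y : Fin 3 → ℂ) : ‖herm x y‖ = ‖herm y x‖ := by
  rw [← conj_herm x y, Complex.norm_conj]

theorem herm_self (x : Fin 3 → ℂ) : herm x x = ((herm x x).re : ℂ) := by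
  have := conj_herm x x
  rw [Complex.conj_eq_iff_re] at this
  exact this.symm

theorem herm_self_re_norm (y : Fin 3 → ℂ) :
    (herm y y).re = ‖y 0‖ ^ 2 + ‖y 1‖ ^ 2 - ‖y 2‖ ^ 2 := by
  simp only [herm_self_re, Complex.normSq_eq_norm_sq]

theorem herm_smul_smul_re (a : ℂ) (x : Fin 3 → ℂ) :
    (herm (a • x) (a • x)).re = ‖a‖ ^ 2 * (herm x x).re := by
  rw [herm_smul_left, herm_smul_right, ← mul_assoc, Complex.mul_conj, Complex.normSq_eq_norm_sq,
    Complex.re_ofReal_mul]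

/-- The expansion of the norm of a sum of orthogonal vectors. -/
theorem herm_add_self_re {x y : Fin 3 → ℂ} (h : herm x y = 0) :
    (herm (x + y) (x + y)).re = (herm x x).re + (herm y y).re := by
  rw [herm_add_left, herm_add_right, herm_add_right, h, herm_eq_zero_comm.1 h]
  simp

theorem normSq_add_le (a b x y : ℂ) :
    ‖a * starRingEnd ℂ x + b * starRingEnd ℂ y‖ ^ 2
      ≤ (‖a‖ ^ 2 + ‖b‖ ^ 2) * (‖x‖ ^ 2 + ‖y‖ ^ 2) := by
  have h1 : ‖a * starRingEnd ℂ x + b * starRingEnd ℂ y‖ ≤ ‖a‖ * ‖x‖ + ‖b‖ * ‖y‖ := by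
    refine (norm_add_le _ _).trans ?_
    simp
  have h2 := pow_le_pow_left₀ (norm_nonneg _) h1 2
  nlinarith [sq_nonneg (‖a‖ * ‖y‖ - ‖b‖ * ‖x‖)]

/-- The form is positive definite on the orthogonal complement of a negative vector. -/
theorem herm_self_pos_of_orthogonal {x z : Fin 3 → ℂ} (hz : (herm z z).re < 0)
    (h : herm x z = 0) (hx : x ≠ 0) : 0 < (herm x x).re := by
  rw [herm_self_re_norm] at hz ⊢
  have h1 : x 2 * starRingEnd ℂ (z 2) = x 0 * starRingEnd ℂ (z 0) + x 1 * starRingEnd ℂ (z 1) := by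
    unfold herm at h
    linear_combination -h
  -- Cauchy-Schwarz in the first two coordinates bounds `|x₂z₂|²` by `(|x₀|² + |x₁|²)(|z₀|² +
  -- |z₁|²)`, and the last factor is smaller than `|z₂|²` because `z` is negative.
  have h2 := normSq_add_le (x 0) (x 1) (z 0) (z 1)
  rw [← h1, norm_mul, Complex.norm_conj, mul_pow] at h2
  by_contra hcon
  have hz2 : 0 < ‖z 2‖ ^ 2 := by nlinarith [sq_nonneg ‖z 0‖, sq_nonneg ‖z 1‖]
  have hA : 0 ≤ ‖x 0‖ ^ 2 + ‖x 1‖ ^ 2 := by positivity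
  have hA0 : ‖x 0‖ ^ 2 + ‖x 1‖ ^ 2 = 0 := by
    by_contra hne
    have hA' : 0 < ‖x 0‖ ^ 2 + ‖x 1‖ ^ 2 := lt_of_le_of_ne hA (Ne.symm hne)
    nlinarith
  have hx2 : ‖x 2‖ ^ 2 = 0 := by
    rw [hA0] at h2
    have : 0 ≤ ‖x 2‖ ^ 2 := by positivity
    nlinarith
  apply hx
  ext i
  fin_cases i
  · simpa using (by nlinarith [sq_nonneg ‖x 0‖, sq_nonneg ‖x 1‖] : ‖x 0‖ ^ 2 = 0)
  · simpa using (by nlinarith [sq_nonneg ‖x 0‖, sq_nonneg ‖x 1‖] : ‖x 1‖ ^ 2 = 0)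
  · simpa using hx2

theorem herm_self_nonneg_of_orthogonal {x z : Fin 3 → ℂ} (hz : (herm z z).re < 0)
    (h : herm x z = 0) : 0 ≤ (herm x x).re := by
  by_cases hx : x = 0
  · simp [hx, herm]
  · exact (herm_self_pos_of_orthogonal hz h hx).le

/-- The Cauchy-Schwarz inequality in the orthogonal complement of a negative vector. -/
theorem herm_cauchy_schwarz {u v z : Fin 3 → ℂ} (hz : (herm z z).re < 0)
    (hu : herm u z = 0) (hv : herm v z = 0) :
    ‖herm u v‖ ^ 2 ≤ (herm u u).re * (herm v v).re := by
  by_cases hv0 : v = 0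
  · simp [hv0, herm]
  have hvv := herm_self_pos_of_orthogonal hz hv hv0
  -- The norm of this vector is `⟨v,v⟩` times the defect in the Cauchy-Schwarz inequality.
  have hw : herm (herm v v • u - herm u v • v) z = 0 := by
    rw [herm_sub_left, herm_smul_left, herm_smul_left, hu, hv]; ring
  have h := herm_self_nonneg_of_orthogonal hz hw
  have key : herm (herm v v • u - herm u v • v) (herm v v • u - herm u v • v)
      = (((herm v v).re * ((herm u u).re * (herm v v).re - ‖herm u v‖ ^ 2) : ℝ) : ℂ) := by
    simp only [herm_sub_left, herm_sub_right, herm_smul_left, herm_smul_right, conj_herm]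
    push_cast
    rw [← herm_self v, ← herm_self u, ← Complex.mul_conj', conj_herm]
    ring
  rw [key, Complex.ofReal_re] at h
  nlinarith [nonneg_of_mul_nonneg_right h hvv]

/-! ### Matrices in `U(2,1)` and their topology -/

/-- The Gram matrix of the form in the standard basis. -/
def J : Matrix (Fin 3) (Fin 3) ℂ := Matrix.diagonal ![1, 1, -1]

theorem J_mul_J : J * J = 1 := by
  rw [J, Matrix.diagonal_mul_diagonal, ← Matrix.diagonal_one]
  congr 1
  ext i
  fin_cases i <;> simp

theorem det_J : J.det = -1 := by
  simp [J, Fin.prod_univ_three]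

theorem herm_eq_dotProduct (x y : Fin 3 → ℂ) : herm x y = star y ⬝ᵥ J.mulVec x := by
  simp [herm, J, Matrix.mulVec_diagonal, dotProduct, Fin.sum_univ_three]
  ring

theorem herm_mulVec (M N : Matrix (Fin 3) (Fin 3) ℂ) (x y : Fin 3 → ℂ) :
    herm (M.mulVec x) (N.mulVec y) = star y ⬝ᵥ (Nᴴ * J * M).mulVec x := by
  rw [herm_eq_dotProduct, Matrix.star_mulVec, ← Matrix.mulVec_mulVec, ← Matrix.mulVec_mulVec,
    Matrix.dotProduct_mulVec (star y)]

theorem preserves_iff {M : Matrix (Fin 3) (Fin 3) ℂ} :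
    (∀ x y, herm (M.mulVec x) (M.mulVec y) = herm x y) ↔ Mᴴ * J * M = J := by
  constructor
  · intro h
    ext i j
    have := h (Pi.single j 1) (Pi.single i 1)
    rw [herm_mulVec, herm_eq_dotProduct] at this
    simpa [← Pi.single_star] using this
  · intro h x y
    rw [herm_mulVec, h, herm_eq_dotProduct]

/-- The element of `U(2,1)` given by a matrix preserving the form. -/
def ofMatrix (M : Matrix (Fin 3) (Fin 3) ℂ) (h : Mᴴ * J * M = J) : U21 :=
  ⟨⟨M, J * Mᴴ * J, by
      apply mul_eq_one_comm.1
      rw [Matrix.mul_assoc, Matrix.mul_assoc, ← Matrix.mul_assoc Mᴴ, h, J_mul_J], by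
      rw [Matrix.mul_assoc, Matrix.mul_assoc, ← Matrix.mul_assoc Mᴴ, h, J_mul_J]⟩,
    preserves_iff.2 h⟩

theorem U21_ext {g h : U21} (H : ∀ x, g.val.val.mulVec x = h.val.val.mulVec x) : g = h := by
  apply Subtype.ext
  apply Units.ext
  exact Matrix.ext_of_mulVec_single fun i => H _

theorem continuous_ofMatrix :
    Continuous fun M : {M : Matrix (Fin 3) (Fin 3) ℂ // Mᴴ * J * M = J} => ofMatrix M.1 M.2 := by
  refine Continuous.subtype_mk (Units.continuous_iff.2 ⟨continuous_subtype_val, ?_⟩) _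
  change Continuous fun M : {M : Matrix (Fin 3) (Fin 3) ℂ // Mᴴ * J * M = J} => J * M.1ᴴ * J
  fun_prop

theorem continuous_coe_U21 : Continuous fun g : U21 => g.val.val :=
  Units.continuous_val.comp continuous_subtype_val

theorem mul_mulVec (g h : U21) (x : Fin 3 → ℂ) :
    (g * h).val.val.mulVec x = g.val.val.mulVec (h.val.val.mulVec x) := by
  rw [Matrix.mulVec_mulVec]; rfl

theorem inv_mulVec_mulVec (g : U21) (x : Fin 3 → ℂ) :
    (g⁻¹).val.val.mulVec (g.val.val.mulVec x) = x := by
  rw [← mul_mulVec, inv_mul_cancel]; simp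

theorem mulVec_inv_mulVec (g : U21) (x : Fin 3 → ℂ) :
    g.val.val.mulVec ((g⁻¹).val.val.mulVec x) = x := by
  rw [← mul_mulVec, mul_inv_cancel]; simp

theorem herm_inv_mulVec (g : U21) (x y : Fin 3 → ℂ) :
    herm ((g⁻¹).val.val.mulVec x) y = herm x (g.val.val.mulVec y) := by
  rw [← g.2, mulVec_inv_mulVec]

theorem mulVec_ne_zero (g : U21) {x : Fin 3 → ℂ} (hx : x ≠ 0) : g.val.val.mulVec x ≠ 0 := by
  intro h
  apply hx
  rw [← inv_mulVec_mulVec g x, h, Matrix.mulVec_zero]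

theorem lift_neg (z : H2) : (herm (lift z.1) (lift z.1)).re < 0 := by
  have := z.2
  rw [herm_self_re]
  simp [lift]; linarith

theorem lift_smul (g : U21) (z : H2) :
    lift (g • z).1 = (g.val.val.mulVec (lift z.1) 2)⁻¹ • g.val.val.mulVec (lift z.1) := by
  rw [coe_smul, lift_dehom (coord_ne_zero (herm_image_neg g z))]

theorem mk_eq_mk_iff {g h : U21} :
    (QuotientGroup.mk g : PU21) = QuotientGroup.mk h ↔
      ∃ a : ℂ, ∀ x, h.val.val.mulVec x = a • g.val.val.mulVec x := by
  rw [QuotientGroup.eq]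
  constructor
  · rintro ⟨a, ha⟩
    refine ⟨a, fun x => ?_⟩
    rw [← mulVec_inv_mulVec g (h.val.val.mulVec x), ← mul_mulVec g⁻¹ h, ha, Matrix.mulVec_smul]
  · rintro ⟨a, ha⟩
    refine ⟨a, fun x => ?_⟩
    rw [mul_mulVec, ha, Matrix.mulVec_smul, inv_mulVec_mulVec]

/-- No three positive vectors are pairwise orthogonal. -/
theorem not_three_orthogonal {c d e : Fin 3 → ℂ} (hc : 0 < (herm c c).re) (hd : 0 < (herm d d).re)
    (he : 0 < (herm e e).re) (hcd : herm c d = 0) (hce : herm c e = 0) (hde : herm d e = 0) :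
    False := by
  let M : Matrix (Fin 3) (Fin 3) ℂ := (Matrix.of ![c, d, e])ᵀ
  have h : Mᴴ * J * M = Matrix.diagonal ![herm c c, herm d d, herm e e] := by
    ext i j
    have h1 : (Mᴴ * J * M) i j = herm (M.col j) (M.col i) := by
      have := herm_mulVec M M (Pi.single j 1) (Pi.single i 1)
      simpa [← Pi.single_star] using this.symm
    have hM : M.col = ![c, d, e] := by
      ext i j; rfl
    rw [h1, hM]
    fin_cases i <;> fin_cases j <;>
      simp [hcd, hce, hde, herm_eq_zero_comm.1 hcd, herm_eq_zero_comm.1 hce,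
        herm_eq_zero_comm.1 hde]
  -- The Gram determinant equals `-|det M|² ≤ 0`, whereas the diagonal entries are positive.
  have h2 := congrArg Matrix.det h
  rw [Matrix.det_mul, Matrix.det_mul, Matrix.det_conjTranspose, det_J, Matrix.det_diagonal,
    Fin.prod_univ_three, mul_neg_one, neg_mul, mul_comm, Complex.star_def, Complex.mul_conj] at h2
  simp only [Matrix.cons_val] at h2
  rw [herm_self c, herm_self d, herm_self e] at h2
  have h3 : -Complex.normSq M.det = (herm c c).re * (herm d d).re * (herm e e).re := by
    exact_mod_cast h2
  have h4 := Complex.normSq_nonneg M.det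
  have h5 : 0 < (herm c c).re * (herm d d).re * (herm e e).re := by positivity
  linarith

/-- The topology of the unit group also involves the inverse, but on `U(2,1)` the inverse is `J Mᴴ
J`. Convergence of the matrices is therefore enough. -/
theorem tendsto_mk_of_tendsto_coe {ι : Type*} {l : Filter ι} {u : ι → U21} {g : U21}
    (h : Tendsto (fun k => (u k).val.val) l (𝓝 g.val.val)) :
    Tendsto (fun k => (QuotientGroup.mk (u k) : PU21)) l (𝓝 (QuotientGroup.mk g)) := by
  refine (continuous_quotient_mk'.tendsto g).comp ?_
  have h1 : Tendsto (fun k => (⟨(u k).val.val, preserves_iff.1 (u k).2⟩ :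
      {M : Matrix (Fin 3) (Fin 3) ℂ // Mᴴ * J * M = J})) l
      (𝓝 ⟨g.val.val, preserves_iff.1 g.2⟩) := tendsto_subtype_rng.2 h
  have h2 := (continuous_ofMatrix.tendsto _).comp h1
  have h3 : ∀ g : U21, ofMatrix g.val.val (preserves_iff.1 g.2) = g := fun g =>
    U21_ext fun x => rfl
  simpa only [Function.comp_def, h3] using h2

/-! ### Complex reflections -/

/-- The matrix of the complex reflection with rotation factor `ζ` and polar vector `d`. -/
def reflMatrix (ζ : ℂ) (d : Fin 3 → ℂ) : Matrix (Fin 3) (Fin 3) ℂ :=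
  1 + ((ζ - 1) / herm d d) • Matrix.vecMulVec d (J.mulVec (star d))

theorem reflMatrix_mulVec (ζ : ℂ) (d x : Fin 3 → ℂ) :
    (reflMatrix ζ d).mulVec x = x + ((ζ - 1) * (herm x d / herm d d)) • d := by
  rw [reflMatrix, Matrix.add_mulVec, Matrix.one_mulVec, Matrix.smul_mulVec,
    Matrix.vecMulVec_mulVec]
  congr 1
  have : J.mulVec (star d) ⬝ᵥ x = herm x d := by
    simp [herm, J, Matrix.mulVec_diagonal, dotProduct, Fin.sum_univ_three]; ring
  rw [this]
  ext i
  simp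
  ring

theorem reflMatrix_preserves {ζ : ℂ} (hζ : ‖ζ‖ = 1) {d : Fin 3 → ℂ} (hd : herm d d ≠ 0) :
    (reflMatrix ζ d)ᴴ * J * reflMatrix ζ d = J := by
  rw [← preserves_iff]
  intro x y
  simp only [reflMatrix_mulVec, herm_add_left, herm_add_right, herm_smul_left, herm_smul_right,
    map_mul, map_sub, map_div₀, map_one, conj_herm]
  have h1 : ζ * starRingEnd ℂ ζ = 1 := by
    rw [Complex.mul_conj, Complex.normSq_eq_norm_sq, hζ]; simp
  field_simp
  linear_combination (herm x d * herm d y) * h1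

/-- The complex reflection with rotation factor `ζ` and polar vector `d`, in `U(2,1)`. -/
def refl (ζ : Circle) (d : Fin 3 → ℂ) (hd : herm d d ≠ 0) : U21 :=
  ofMatrix (reflMatrix ζ d) (reflMatrix_preserves ζ.norm_coe hd)

theorem refl_mulVec (ζ : Circle) (d : Fin 3 → ℂ) (hd : herm d d ≠ 0) (x : Fin 3 → ℂ) :
    (refl ζ d hd).val.val.mulVec x = x + (((ζ : ℂ) - 1) * (herm x d / herm d d)) • d :=
  reflMatrix_mulVec _ _ _

/-- The complex reflections with a given mirror, as a homomorphism. -/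
def reflHom (d : Fin 3 → ℂ) (hd : herm d d ≠ 0) : Circle →* U21 where
  toFun ζ := refl ζ d hd
  map_one' := U21_ext fun x => by simp [refl_mulVec]
  map_mul' ζ ξ := U21_ext fun x => by
    rw [mul_mulVec, refl_mulVec, refl_mulVec, refl_mulVec, herm_add_left, herm_smul_left,
      add_assoc, ← add_smul]
    congr 2
    push_cast
    field_simp
    ring

theorem refl_conj (g : U21) (ζ : Circle) (d : Fin 3 → ℂ) (hd : herm d d ≠ 0) :
    g * refl ζ d hd * g⁻¹ = refl ζ (g.val.val.mulVec d) (by rwa [g.2]) := by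
  refine U21_ext fun x => ?_
  rw [mul_mulVec, mul_mulVec, refl_mulVec, refl_mulVec, Matrix.mulVec_add, mulVec_inv_mulVec,
    Matrix.mulVec_smul, herm_inv_mulVec, g.2]

theorem exists_ne_zero_orthogonal (c d : Fin 3 → ℂ) :
    ∃ x : Fin 3 → ℂ, x ≠ 0 ∧ herm x c = 0 ∧ herm x d = 0 := by
  let M : Matrix (Fin 3) (Fin 3) ℂ := Matrix.of ![J.mulVec (star c), J.mulVec (star d), 0]
  have hM : M.det = 0 := Matrix.det_eq_zero_of_row_eq_zero 2 fun j => by simp [M]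
  obtain ⟨x, hx, hMx⟩ := Matrix.exists_mulVec_eq_zero_iff.2 hM
  refine ⟨x, hx, ?_, ?_⟩
  · have := congrFun hMx 0
    simp [M, J, Matrix.mulVec, dotProduct, Fin.sum_univ_three] at this
    unfold herm
    linear_combination this
  · have := congrFun hMx 1
    simp [M, J, Matrix.mulVec, dotProduct, Fin.sum_univ_three] at this
    unfold herm
    linear_combination this

/-- Two complex reflections which coincide in `PU(2,1)` have proportional polar vectors. -/
theorem polar_eq_of_mk_refl_eq {ζ : Circle} (hζ : (ζ : ℂ) ≠ 1) {c d : Fin 3 → ℂ}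
    (hc : herm c c ≠ 0) (hd : herm d d ≠ 0)
    (h : (QuotientGroup.mk (refl ζ c hc) : PU21) = QuotientGroup.mk (refl ζ d hd)) :
    c = (herm c d / herm d d) • d := by
  obtain ⟨a, ha⟩ := mk_eq_mk_iff.1 h
  -- A vector orthogonal to both polar vectors is fixed by both reflections, so the scalar relating
  -- them is `1`. Evaluation at `c` then gives the proportionality.
  obtain ⟨x, hx, hxc, hxd⟩ := exists_ne_zero_orthogonal c d
  have h1 := ha x
  rw [refl_mulVec, refl_mulVec, hxc, hxd] at h1
  simp only [zero_div, mul_zero, zero_smul, add_zero] at h1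
  have ha1 : a = 1 := by
    have : (a - 1) • x = 0 := by rw [sub_smul, ← h1]; simp
    rcases smul_eq_zero.1 this with h | h
    · linear_combination h
    · exact absurd h hx
  have h2 := ha c
  rw [refl_mulVec, refl_mulVec, ha1, one_smul, add_right_inj, div_self hc, mul_one,
    mul_smul] at h2
  exact (smul_right_injective _ (sub_ne_zero.2 hζ) h2).symm

/-! ### The Jørgensen inequality -/

/-- On the unit circle `2 Re(ζ - 1) = -‖ζ - 1‖²`, which turns the cross term into the linear term.
-/
theorem norm_sq_recursion {ζ : ℂ} (hζ : ‖ζ‖ = 1) (x : ℝ) :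
    ‖1 + (ζ - 1) * x‖ ^ 2 = 1 - ‖ζ - 1‖ ^ 2 * x + ‖ζ - 1‖ ^ 2 * x ^ 2 := by
  have h : ‖ζ‖ ^ 2 = 1 := by rw [hζ]; norm_num
  simp only [← Complex.normSq_eq_norm_sq, Complex.normSq_apply] at h ⊢
  simp
  linear_combination x * h

/-- The recursion reads `x (k+1) - 1 = τ x k (x k - 1)`. The bound `x k ≤ max 1 (x 0)` is preserved,
so each step contracts towards the fixed point `1` by the factor `θ = τ max 1 (x 0) < 1`. -/
theorem quadratic_recursion_tendsto {τ : ℝ} (hτ0 : 0 ≤ τ) (hτ : τ < 1) {x : ℕ → ℝ}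
    (hx0 : 0 < x 0) (hτx : τ * x 0 < 1) (hx : ∀ k, x (k + 1) = 1 - τ * x k + τ * x k ^ 2) :
    ∃ θ : ℝ, 0 ≤ θ ∧ θ < 1 ∧ (∀ k, 0 < x k ∧ τ * x k ≤ θ) ∧ Tendsto x atTop (𝓝 1) := by
  set m := max 1 (x 0) with hm
  have hm1 : 1 ≤ m := le_max_left _ _
  have hτm : τ * m < 1 := by
    rcases max_choice 1 (x 0) with h | h <;> rw [hm, h] <;> linarith
  have hxm : ∀ k, 0 < x k ∧ x k ≤ m := by
    intro k
    induction k with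
    | zero => exact ⟨hx0, le_max_right _ _⟩
    | succ k ih =>
      obtain ⟨h0, h1⟩ := ih
      rw [hx]
      refine ⟨?_, ?_⟩
      · nlinarith [sq_nonneg (x k - 1 / 2)]
      · have h2 : τ * x k ≤ 1 := (mul_le_mul_of_nonneg_left h1 hτ0).trans hτm.le
        have h3 : 0 ≤ τ * x k := mul_nonneg hτ0 h0.le
        rcases le_total (x k) 1 with h | h
        · nlinarith
        · nlinarith
  refine ⟨τ * m, by positivity, hτm, fun k => ⟨(hxm k).1,
    mul_le_mul_of_nonneg_left (hxm k).2 hτ0⟩, ?_⟩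
  have hgeo : ∀ k, |x k - 1| ≤ (τ * m) ^ k * |x 0 - 1| := by
    intro k
    induction k with
    | zero => simp
    | succ k ih =>
      have : x (k + 1) - 1 = τ * x k * (x k - 1) := by rw [hx]; ring
      rw [this, abs_mul, abs_of_nonneg (mul_nonneg hτ0 (hxm k).1.le), pow_succ']
      rw [mul_assoc (τ * m)]
      exact mul_le_mul (mul_le_mul_of_nonneg_left (hxm k).2 hτ0) ih (abs_nonneg _) (by positivity)
  rw [tendsto_iff_norm_sub_tendsto_zero]
  refine squeeze_zero (fun _ => norm_nonneg _) hgeo ?_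
  simpa using (tendsto_pow_atTop_nhds_zero_of_lt_one (by positivity) hτm).mul_const |x 0 - 1|

/-- The sequence of elements obtained by iterated conjugation of a reflection. -/
def conjSeq (R g : U21) : ℕ → U21
  | 0 => g
  | k + 1 => conjSeq R g k * R * (conjSeq R g k)⁻¹

/-- A Jørgensen type inequality for a complex reflection and an image of its mirror. -/
theorem jorgensen_inequality (Γ : Subgroup PU21) [DiscreteTopology Γ] {ζ : Circle}
    (hζ1 : (ζ : ℂ) ≠ 1) (hζ : ‖(ζ : ℂ) - 1‖ < 1) {c : Fin 3 → ℂ} (hc : herm c c ≠ 0)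
    (hR : QuotientGroup.mk (refl ζ c hc) ∈ Γ) {g : U21} (hg : QuotientGroup.mk g ∈ Γ) :
    (∃ a : ℂ, g.val.val.mulVec c = a • c) ∨ herm (g.val.val.mulVec c) c = 0 ∨
      ‖herm c c‖ ≤ ‖(ζ : ℂ) - 1‖ * ‖herm (g.val.val.mulVec c) c‖ := by
  by_contra! hcon
  obtain ⟨hnp, hno, hlt⟩ := hcon
  set R := refl ζ c hc with hRdef
  let G := conjSeq R g
  let d : ℕ → Fin 3 → ℂ := fun k => (G k).val.val.mulVec c
  have hdd : ∀ k, herm (d k) (d k) = herm c c := fun k => (G k).2 c c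
  -- From index `1` on, the sequence consists of reflections with the same rotation factor and polar
  -- vectors `d k`. Only `G 0 = g` is arbitrary, hence the index shifts below.
  have hG : ∀ k, G (k + 1) = refl ζ (d k) (by rw [hdd]; exact hc) := fun k => refl_conj _ _ _ _
  have hGΓ : ∀ k, (QuotientGroup.mk (G k) : PU21) ∈ Γ := by
    intro k
    induction k with
    | zero => exact hg
    | succ k ih =>
      change (QuotientGroup.mk (G k * R * (G k)⁻¹) : PU21) ∈ Γ
      rw [QuotientGroup.mk_mul, QuotientGroup.mk_mul, QuotientGroup.mk_inv]
      exact Γ.mul_mem (Γ.mul_mem ih hR) (Γ.inv_mem ih)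
  let α : ℕ → ℂ := fun k => herm (d k) c / herm c c
  have hconj : ∀ k, herm c (d k) / herm c c = starRingEnd ℂ (α k) := by
    intro k
    simp only [α, map_div₀, conj_herm]
  have hd : ∀ k, d (k + 1) = c + (((ζ : ℂ) - 1) * starRingEnd ℂ (α k)) • d k := by
    intro k
    change (G (k + 1)).val.val.mulVec c = _
    rw [hG, refl_mulVec, hdd, hconj]
  have hα : ∀ k, α (k + 1) = 1 + ((ζ : ℂ) - 1) * ((‖α k‖ ^ 2 : ℝ) : ℂ) := by
    intro k
    change herm (d (k + 1)) c / herm c c = _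
    rw [hd, herm_add_left, herm_smul_left, add_div, div_self hc, mul_div_assoc, mul_assoc]
    change 1 + ((ζ : ℂ) - 1) * (starRingEnd ℂ (α k) * α k) = _
    rw [Complex.conj_mul']
    push_cast
    rfl
  obtain ⟨θ, hθ0, hθ1, hθ, hlim⟩ := quadratic_recursion_tendsto (τ := ‖(ζ : ℂ) - 1‖ ^ 2)
    (x := fun k => ‖α k‖ ^ 2) (by positivity) (by nlinarith [norm_nonneg ((ζ : ℂ) - 1)])
    (by
      have : α 0 ≠ 0 := div_ne_zero hno hc
      positivity)
    (by
      have h1 : ‖(ζ : ℂ) - 1‖ * ‖α 0‖ < 1 := by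
        change ‖(ζ : ℂ) - 1‖ * ‖herm (g.val.val.mulVec c) c / herm c c‖ < 1
        rw [norm_div, ← mul_div_assoc, div_lt_one (norm_pos_iff.2 hc)]
        exact hlt
      have h2 : 0 ≤ ‖(ζ : ℂ) - 1‖ * ‖α 0‖ := by positivity
      rw [← mul_pow]
      nlinarith)
    (fun k => by
      simp only [hα]
      rw [norm_sq_recursion ζ.norm_coe])
  -- The component of `d k` orthogonal to `c`. Each step multiplies it by a nonzero scalar of
  -- modulus at most `√θ`, so it tends to zero without vanishing.
  let v : ℕ → Fin 3 → ℂ := fun k => d k - α k • c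
  have hv : ∀ k, v (k + 1) = (((ζ : ℂ) - 1) * starRingEnd ℂ (α k)) • v k := by
    intro k
    change d (k + 1) - α (k + 1) • c = _ • (d k - α k • c)
    have : ((‖α k‖ ^ 2 : ℝ) : ℂ) = starRingEnd ℂ (α k) * α k := by
      rw [Complex.conj_mul']; push_cast; rfl
    rw [hd, hα, this, smul_sub, smul_smul]
    module
  have hv0 : ∀ k, v k ≠ 0 := by
    intro k
    induction k with
    | zero =>
      intro h
      exact hnp (α 0) (sub_eq_zero.1 h)
    | succ k ih =>
      rw [hv]
      refine smul_ne_zero (mul_ne_zero (sub_ne_zero.2 hζ1) ?_) ih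
      rw [Ne, map_eq_zero]
      intro h
      simpa [h] using (hθ k).1
  have hvlim : Tendsto v atTop (𝓝 0) := by
    have hb : ∀ k, ‖v k‖ ≤ Real.sqrt θ ^ k * ‖v 0‖ := by
      intro k
      induction k with
      | zero => simp
      | succ k ih =>
        rw [hv, norm_smul, pow_succ', mul_assoc]
        refine mul_le_mul ?_ ih (norm_nonneg _) (Real.sqrt_nonneg _)
        apply Real.le_sqrt_of_sq_le
        rw [norm_mul, mul_pow, Complex.norm_conj]
        exact (hθ k).2
    refine squeeze_zero_norm hb ?_
    have : Real.sqrt θ < 1 := by rw [Real.sqrt_lt' one_pos]; simpa using hθ1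
    simpa using (tendsto_pow_atTop_nhds_zero_of_lt_one (Real.sqrt_nonneg _) this).mul_const ‖v 0‖
  have hαlim : Tendsto (fun k => α (k + 1)) atTop (𝓝 (ζ : ℂ)) := by
    have h1 : Tendsto (fun k => 1 + ((ζ : ℂ) - 1) * ((‖α k‖ ^ 2 : ℝ) : ℂ)) atTop
        (𝓝 (1 + ((ζ : ℂ) - 1) * ((1 : ℝ) : ℂ))) :=
      tendsto_const_nhds.add (tendsto_const_nhds.mul
        ((Complex.continuous_ofReal.tendsto 1).comp hlim))
    simp only [hα]
    simpa using h1
  have hdlim : Tendsto d atTop (𝓝 ((ζ : ℂ) • c)) := by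
    have h1 := hvlim.add (((tendsto_add_atTop_iff_nat 1).1 hαlim).smul_const c)
    simpa [v] using h1
  -- The limit of `d k` is `ζ c`, not `c`, but a unit factor in the polar vector does not change the
  -- reflection.
  have hmat : Tendsto (fun k => (G (k + 1)).val.val) atTop (𝓝 R.val.val) := by
    have h0 : ∀ k, (G (k + 1)).val.val = 1 + (((ζ : ℂ) - 1) / herm c c) •
        Matrix.vecMulVec (d k) (J.mulVec (star (d k))) := by
      intro k
      rw [hG]
      change reflMatrix ζ (d k) = _
      rw [reflMatrix, hdd]
    have h1 : R.val.val = 1 + (((ζ : ℂ) - 1) / herm c c) •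
        Matrix.vecMulVec ((ζ : ℂ) • c) (J.mulVec (star ((ζ : ℂ) • c))) := by
      change reflMatrix ζ c = _
      rw [reflMatrix, star_smul, Matrix.mulVec_smul, Matrix.smul_vecMulVec,
        Matrix.vecMulVec_smul, smul_smul (ζ : ℂ), Complex.star_def, Complex.mul_conj,
        Complex.normSq_eq_norm_sq, ζ.norm_coe]
      simp
    simp only [h0]
    rw [h1]
    have hcont : Continuous fun e : Fin 3 → ℂ => 1 + (((ζ : ℂ) - 1) / herm c c) •
        Matrix.vecMulVec e (J.mulVec (star e)) := by
      fun_prop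
    exact (hcont.tendsto _).comp hdlim
  have hmk := tendsto_mk_of_tendsto_coe hmat
  have hsub : Tendsto (fun k => (⟨QuotientGroup.mk (G (k + 1)), hGΓ _⟩ : Γ)) atTop
      (𝓝 ⟨QuotientGroup.mk R, hR⟩) := tendsto_subtype_rng.2 hmk
  -- In a discrete group the convergent sequence is eventually equal to its limit, which makes some
  -- `d k` proportional to `c` and contradicts `v k ≠ 0`.
  rw [nhds_discrete, tendsto_pure] at hsub
  obtain ⟨k, hk⟩ := hsub.exists
  have hk' := congrArg Subtype.val hk
  simp only [hG] at hk'
  have hpol := polar_eq_of_mk_refl_eq hζ1 _ _ hk'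
  apply hv0 k
  change d k - _ = 0
  rw [sub_eq_zero]
  exact hpol

/-! ### Points, lines and the action -/

/-- The point of the complex hyperbolic plane represented by a negative vector. -/
def mkPt (x : Fin 3 → ℂ) (hx : (herm x x).re < 0) : H2 := ⟨dehom x, dehom_mem hx⟩

theorem lift_mkPt (x : Fin 3 → ℂ) (hx : (herm x x).re < 0) :
    lift (mkPt x hx).1 = (x 2)⁻¹ • x := lift_dehom (coord_ne_zero hx)

theorem smul_mkPt (g : U21) (x : Fin 3 → ℂ) (hx : (herm x x).re < 0) :
    g • mkPt x hx = mkPt (g.val.val.mulVec x) (by rwa [g.2]) := by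
  apply Subtype.ext
  rw [coe_smul, lift_mkPt, Matrix.mulVec_smul, dehom_smul (inv_ne_zero (coord_ne_zero hx))]
  rfl

theorem mulVec_eq_smul_of_fixed {g : U21} {x : Fin 3 → ℂ} (hx : (herm x x).re < 0)
    (h : g • mkPt x hx = mkPt x hx) : ∃ a : ℂ, g.val.val.mulVec x = a • x := by
  rw [smul_mkPt] at h
  have h1 := congrArg (fun z : H2 => lift z.1) h
  simp only [lift_mkPt] at h1
  have hg : g.val.val.mulVec x 2 ≠ 0 := coord_ne_zero (by rwa [g.2])
  refine ⟨g.val.val.mulVec x 2 * (x 2)⁻¹, ?_⟩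
  rw [mul_smul, ← h1, smul_smul, mul_inv_cancel₀ hg, one_smul]

theorem mkPt_mem_complexLine {x c : Fin 3 → ℂ} (hx : (herm x x).re < 0) (h : herm x c = 0) :
    mkPt x hx ∈ complexLine c := by
  change herm (lift (mkPt x hx).1) c = 0
  rw [lift_mkPt, herm_smul_left, h, mul_zero]

theorem lift_inv_smul (g : U21) (z : H2) :
    ∃ a : ℂ, a ≠ 0 ∧ lift (g⁻¹ • z).1 = a • (g⁻¹).val.val.mulVec (lift z.1) := by
  refine ⟨_, inv_ne_zero (coord_ne_zero (herm_image_neg g⁻¹ z)), lift_smul _ _⟩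

theorem smul_complexLine (g : U21) (c : Fin 3 → ℂ) :
    (QuotientGroup.mk g : PU21) • complexLine c = complexLine (g.val.val.mulVec c) := by
  ext z
  rw [Set.mem_smul_set_iff_inv_smul_mem, ← QuotientGroup.mk_inv, mk_smul]
  change herm (lift (g⁻¹ • z).1) c = 0 ↔ herm (lift z.1) _ = 0
  obtain ⟨a, ha, h⟩ := lift_inv_smul g z
  rw [h, herm_smul_left, herm_inv_mulVec]
  simp [ha]

theorem eq_zero_of_herm_eq_zero {w : Fin 3 → ℂ} (h : ∀ y, herm w y = 0) : w = 0 := by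
  ext i
  have := h (Pi.single i 1)
  fin_cases i <;> simpa [herm, Pi.single_apply] using this

theorem herm_sub_proj {c : Fin 3 → ℂ} (hc : herm c c ≠ 0) (x : Fin 3 → ℂ) :
    herm (x - (herm x c / herm c c) • c) c = 0 := by
  rw [herm_sub_left, herm_smul_left]
  field_simp
  ring

theorem eq_smul_of_orthogonal {c d : Fin 3 → ℂ} (hc : herm c c ≠ 0)
    (h : ∀ x, herm x c = 0 → herm x d = 0) : d = (herm d c / herm c c) • c := by
  rw [← sub_eq_zero]
  apply eq_zero_of_herm_eq_zero
  intro y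
  have h1 := herm_sub_proj hc d
  have h2 := herm_sub_proj hc y
  have h3 : y = (y - (herm y c / herm c c) • c) + (herm y c / herm c c) • c := by abel
  rw [h3, herm_add_right, herm_smul_right, h1, mul_zero, add_zero, herm_sub_left, herm_smul_left,
    herm_eq_zero_comm.1 h2, herm_eq_zero_comm.1 (h _ h2)]
  ring

theorem herm_self_ne_zero {c : Fin 3 → ℂ} (hc : 0 < (herm c c).re) : herm c c ≠ 0 := by
  intro h
  simp [h] at hc

theorem proj_self_re {c : Fin 3 → ℂ} (hc : herm c c ≠ 0) (x : Fin 3 → ℂ) :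
    (herm (x - (herm x c / herm c c) • c) (x - (herm x c / herm c c) • c)).re
      = (herm x x).re - ‖herm x c‖ ^ 2 / (herm c c).re := by
  have hcr : ((herm c c).re : ℂ) ≠ 0 := by rwa [← herm_self]
  have h : herm (x - (herm x c / herm c c) • c) (x - (herm x c / herm c c) • c)
      = (((herm x x).re - ‖herm x c‖ ^ 2 / (herm c c).re : ℝ) : ℂ) := by
    rw [herm_sub_right, herm_smul_right, herm_sub_proj hc, mul_zero, sub_zero, herm_sub_left,
      herm_smul_left, ← conj_herm x c]
    push_cast
    rw [← Complex.mul_conj', ← herm_self x, ← herm_self c]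
    ring
  rw [h, Complex.ofReal_re]

theorem proj_neg {c : Fin 3 → ℂ} (hc : 0 < (herm c c).re) {x : Fin 3 → ℂ}
    (hx : (herm x x).re < 0) :
    (herm (x - (herm x c / herm c c) • c) (x - (herm x c / herm c c) • c)).re < 0 := by
  rw [proj_self_re (herm_self_ne_zero hc)]
  have : 0 ≤ ‖herm x c‖ ^ 2 / (herm c c).re := by positivity
  linarith

/-- The point `0` of the ball model. -/
def origin : H2 := ⟨0, by simp⟩

theorem exists_neg_orthogonal {c : Fin 3 → ℂ} (hc : 0 < (herm c c).re) :
    ∃ x : Fin 3 → ℂ, (herm x x).re < 0 ∧ herm x c = 0 :=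
  ⟨_, proj_neg hc (lift_neg origin), herm_sub_proj (herm_self_ne_zero hc) _⟩

theorem exists_neg_perturbation {x₀ : Fin 3 → ℂ} (h₀ : (herm x₀ x₀).re < 0) (x : Fin 3 → ℂ) :
    ∃ ε : ℂ, ε ≠ 0 ∧ (herm (x₀ + ε • x) (x₀ + ε • x)).re < 0 ∧
      (herm (x₀ - ε • x) (x₀ - ε • x)).re < 0 := by
  have hcont : Continuous fun ε : ℂ => (herm (x₀ + ε • x) (x₀ + ε • x)).re := by
    unfold herm
    simp only [Pi.add_apply, Pi.smul_apply, smul_eq_mul]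
    fun_prop
  have h1 : ∀ᶠ ε : ℂ in 𝓝 0, (herm (x₀ + ε • x) (x₀ + ε • x)).re < 0 :=
    (hcont.tendsto 0).eventually (Iio_mem_nhds (by simpa using h₀))
  have h2 : ∀ᶠ ε : ℂ in 𝓝 0, (herm (x₀ - ε • x) (x₀ - ε • x)).re < 0 := by
    have hneg : Tendsto (fun ε : ℂ => -ε) (𝓝 0) (𝓝 0) := by
      simpa using (continuous_neg.tendsto (0 : ℂ))
    filter_upwards [hneg.eventually h1] with ε hε
    simpa [sub_eq_add_neg] using hε
  have h3 : ∀ᶠ ε : ℂ in 𝓝[≠] 0, ε ≠ 0 ∧ (herm (x₀ + ε • x) (x₀ + ε • x)).re < 0 ∧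
      (herm (x₀ - ε • x) (x₀ - ε • x)).re < 0 := by
    filter_upwards [self_mem_nhdsWithin, nhdsWithin_le_nhds h1, nhdsWithin_le_nhds h2]
      with ε ha hb hc
    exact ⟨ha, hb, hc⟩
  exact h3.exists

/-- An isometry acting by a scalar on the orthogonal complement of a positive vector is a
complex reflection. -/
theorem exists_mk_eq_mk_refl {g : U21} {c : Fin 3 → ℂ} (hc : 0 < (herm c c).re) {a : ℂ}
    (ha : ∀ x, herm x c = 0 → g.val.val.mulVec x = a • x) :
    ∃ ζ : Circle, (QuotientGroup.mk g : PU21)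
      = QuotientGroup.mk (refl ζ c (herm_self_ne_zero hc)) := by
  have hc0 := herm_self_ne_zero hc
  obtain ⟨x₀, h₀, h₀c⟩ := exists_neg_orthogonal hc
  have hnorm : ∀ (b : ℂ) (x : Fin 3 → ℂ), (herm x x).re ≠ 0 → g.val.val.mulVec x = b • x →
      ‖b‖ = 1 := by
    intro b x hx hb
    have h1 := congrArg Complex.re (g.2 x x)
    rw [hb, herm_smul_smul_re] at h1
    have h2 : ‖b‖ ^ 2 = 1 := mul_right_cancel₀ hx (by rw [h1, one_mul])
    have h3 := norm_nonneg b
    nlinarith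
  have ha1 : ‖a‖ = 1 := hnorm a x₀ h₀.ne (ha x₀ h₀c)
  have ha0 : a ≠ 0 := by
    rintro rfl
    simp at ha1
  -- Since `g` acts on the complement of `c` by a nonzero scalar, it preserves this complement and
  -- hence also the line spanned by `c`.
  have hgc := eq_smul_of_orthogonal (d := g.val.val.mulVec c) hc0 (by
    intro x hx
    have h1 : herm (g.val.val.mulVec x) (g.val.val.mulVec c) = 0 := by rw [g.2, hx]
    rw [ha x hx, herm_smul_left] at h1
    exact (mul_eq_zero.1 h1).resolve_left ha0)
  set b := herm (g.val.val.mulVec c) c / herm c c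
  have hb1 : ‖b‖ = 1 := hnorm b c hc.ne' hgc
  obtain ⟨ζ, hζ⟩ : ∃ ζ : Circle, (ζ : ℂ) = b / a :=
    ⟨⟨b / a, mem_sphere_zero_iff_norm.2 (by rw [norm_div, hb1, ha1, div_one])⟩, rfl⟩
  refine ⟨ζ, ?_⟩
  rw [eq_comm, mk_eq_mk_iff]
  refine ⟨a, fun x => ?_⟩
  have h3 : x = (x - (herm x c / herm c c) • c) + (herm x c / herm c c) • c := by abel
  rw [refl_mulVec, hζ]
  conv_lhs => rw [h3, Matrix.mulVec_add, Matrix.mulVec_smul, hgc, ha _ (herm_sub_proj hc0 x)]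
  rw [smul_sub, smul_add, smul_smul, smul_smul, smul_smul, sub_add, ← sub_smul, sub_eq_add_neg,
    ← neg_smul]
  congr 2
  field_simp
  ring

/-- An isometry fixing a complex line pointwise is a complex reflection. -/
theorem exists_mk_eq_mk_refl_of_fixes {g : U21} {c : Fin 3 → ℂ} (hc : 0 < (herm c c).re)
    (h : ∀ z ∈ complexLine c, g • z = z) :
    ∃ ζ : Circle, (QuotientGroup.mk g : PU21)
      = QuotientGroup.mk (refl ζ c (herm_self_ne_zero hc)) := by
  obtain ⟨x₀, h₀, h₀c⟩ := exists_neg_orthogonal hc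
  have key : ∀ x, (herm x x).re < 0 → herm x c = 0 → ∃ a : ℂ, g.val.val.mulVec x = a • x :=
    fun x hx hxc => mulVec_eq_smul_of_fixed hx (h _ (mkPt_mem_complexLine hx hxc))
  obtain ⟨a, ha⟩ := key x₀ h₀ h₀c
  have hx₀ : x₀ ≠ 0 := by
    rintro rfl
    simp [herm] at h₀
  refine exists_mk_eq_mk_refl hc (a := a) fun x hx => ?_
  by_cases hpar : ∃ β : ℂ, x = β • x₀
  · obtain ⟨β, rfl⟩ := hpar
    rw [Matrix.mulVec_smul, ha, smul_comm]
  -- A fixed point of the ball only says that its negative lifts are eigenvectors. The small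
  -- perturbations `x₀ ± εx` remain negative, and comparing their eigenvalues with that of `x₀`
  -- makes `x` an eigenvector with the same eigenvalue.
  obtain ⟨ε, hε, h1, h2⟩ := exists_neg_perturbation h₀ x
  obtain ⟨p, hp⟩ := key _ h1 (by rw [herm_add_left, herm_smul_left, h₀c, hx]; ring)
  obtain ⟨q, hq⟩ := key _ h2 (by rw [herm_sub_left, herm_smul_left, h₀c, hx]; ring)
  rw [Matrix.mulVec_add, Matrix.mulVec_smul, ha] at hp
  rw [Matrix.mulVec_sub, Matrix.mulVec_smul, ha] at hq
  have hsum : (p - q) • (ε • x) = (2 * a - p - q) • x₀ := by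
    have h3 : (p • (x₀ + ε • x)) + q • (x₀ - ε • x) = (2 * a) • x₀ := by
      rw [← hp, ← hq]
      module
    have h4 : (p - q) • (ε • x) = (p • (x₀ + ε • x)) + q • (x₀ - ε • x) - (p + q) • x₀ := by
      module
    rw [h4, h3]
    module
  have hpq : p = q := by
    by_contra hne
    have hne' := sub_ne_zero.2 hne
    apply hpar
    refine ⟨((p - q) * ε)⁻¹ * (2 * a - p - q), ?_⟩
    rw [mul_smul, ← hsum, smul_smul (p - q), smul_smul,
      inv_mul_cancel₀ (mul_ne_zero hne' hε), one_smul]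
  subst hpq
  rw [sub_self, zero_smul] at hsum
  have hpa : p = a := by
    have := (smul_eq_zero.1 hsum.symm).resolve_right hx₀
    linear_combination -this / 2
  subst hpa
  rw [smul_add, add_right_inj, smul_comm] at hp
  exact smul_right_injective _ hε hp

/-! ### The rotation group of a mirror -/

theorem refl_mem_scalars_iff {ζ : Circle} {c : Fin 3 → ℂ} (hc : herm c c ≠ 0)
    (h : refl ζ c hc ∈ scalars) : ζ = 1 := by
  obtain ⟨a, ha⟩ := h
  obtain ⟨x, hx, hxc, -⟩ := exists_ne_zero_orthogonal c c
  have hc' : c ≠ 0 := by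
    rintro rfl
    simp [herm] at hc
  have h1 := ha x
  rw [refl_mulVec, hxc, zero_div, mul_zero, zero_smul, add_zero] at h1
  have h2 := ha c
  rw [refl_mulVec, div_self hc] at h2
  have ha1 : a = 1 := by
    have : (a - 1) • x = 0 := by rw [sub_smul, ← h1]; simp
    exact sub_eq_zero.1 ((smul_eq_zero.1 this).resolve_right hx)
  rw [ha1, one_smul, mul_one] at h2
  have h3 := (smul_eq_zero.1 (add_eq_left.1 h2)).resolve_right hc'
  exact Circle.ext (sub_eq_zero.1 h3)

/-- The complex reflections with a given mirror, as a homomorphism to `PU(2,1)`. -/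
def mkReflHom (c : Fin 3 → ℂ) (hc : herm c c ≠ 0) : Circle →* PU21 :=
  (QuotientGroup.mk' scalars).comp (reflHom c hc)

theorem mkReflHom_injective (c : Fin 3 → ℂ) (hc : herm c c ≠ 0) :
    Function.Injective (mkReflHom c hc) := by
  rw [injective_iff_map_eq_one]
  intro ζ h
  exact refl_mem_scalars_iff hc ((QuotientGroup.eq_one_iff _).1 h)

theorem continuous_mkReflHom (c : Fin 3 → ℂ) (hc : herm c c ≠ 0) :
    Continuous (mkReflHom c hc) := by
  rw [continuous_iff_continuousAt]
  intro ζ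
  refine tendsto_mk_of_tendsto_coe (u := fun ζ => refl ζ c hc) ?_
  have : Continuous fun ζ : Circle => reflMatrix (ζ : ℂ) c := by
    unfold reflMatrix
    fun_prop
  exact this.tendsto ζ

/-- The group of rotation factors of the complex reflections in `Γ` with a given mirror. -/
def rotationGroup (Γ : Subgroup PU21) (c : Fin 3 → ℂ) (hc : herm c c ≠ 0) : Subgroup Circle :=
  Γ.comap (mkReflHom c hc)

/-- The circle embeds continuously into `PU(2,1)`, so the preimage of `Γ` is a discrete, hence
closed, subgroup of a compact group. -/
theorem finite_rotationGroup (Γ : Subgroup PU21) [DiscreteTopology Γ] (c : Fin 3 → ℂ)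
    (hc : herm c c ≠ 0) : Finite (rotationGroup Γ c hc) := by
  have hd : DiscreteTopology (rotationGroup Γ c hc) :=
    DiscreteTopology.of_continuous_injective
      (f := fun ζ : rotationGroup Γ c hc => (⟨mkReflHom c hc ζ, ζ.2⟩ : Γ))
      (((continuous_mkReflHom c hc).comp continuous_subtype_val).subtype_mk _)
      (fun ζ ξ h => Subtype.ext (mkReflHom_injective c hc (congrArg Subtype.val h)))
  have hclosed : IsClosed (rotationGroup Γ c hc : Set Circle) := Subgroup.isClosed_of_discrete
  have : CompactSpace (rotationGroup Γ c hc) := isCompact_iff_compactSpace.1 hclosed.isCompact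
  exact finite_of_compact_of_discrete

/-- The rotation by the angle `2π / N`. -/
def rotation (N : ℕ) : Circle := Circle.exp (2 * Real.pi / N)

/-- A subgroup of order `N` lies in the `N`-th roots of unity, which are `N` in number, so it
contains all of them. This matters because `A` itself may rotate by a large angle, whereas the
Jørgensen inequality needs the smallest one. -/
theorem rotation_mem_of_finite (K : Subgroup Circle) [Finite K] : rotation (Nat.card K) ∈ K := by
  classical
  have := Fintype.ofFinite K
  set N := Nat.card K with hN
  have hNpos : 0 < N := Nat.card_pos
  have hinj : Function.Injective fun ζ : K => ((ζ : Circle) : ℂ) :=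
    fun ζ ξ h => Subtype.ext (Circle.ext h)
  have hprim : IsPrimitiveRoot (rotation N : ℂ) N := by
    have := Complex.isPrimitiveRoot_exp N hNpos.ne'
    convert this using 1
    rw [rotation, Circle.coe_exp]
    congr 1
    push_cast
    ring
  have hsub : Finset.univ.image (fun ζ : K => ((ζ : Circle) : ℂ))
      ⊆ Polynomial.nthRootsFinset N (1 : ℂ) := by
    intro x hx
    obtain ⟨ζ, -, rfl⟩ := Finset.mem_image.1 hx
    rw [Polynomial.mem_nthRootsFinset hNpos]
    have h1 : ζ ^ N = 1 := pow_card_eq_one'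
    exact_mod_cast congrArg (fun ξ : K => ((ξ : Circle) : ℂ)) h1
  have heq := Finset.eq_of_subset_of_card_le hsub (by
    rw [hprim.card_nthRootsFinset, Finset.card_image_of_injective _ hinj, Finset.card_univ, hN,
      Nat.card_eq_fintype_card])
  have hmem : (rotation N : ℂ) ∈ Polynomial.nthRootsFinset N (1 : ℂ) := by
    rw [Polynomial.mem_nthRootsFinset hNpos]
    exact hprim.pow_eq_one
  rw [← heq] at hmem
  obtain ⟨ζ, -, hζ⟩ := Finset.mem_image.1 hmem
  rw [← Circle.ext hζ]
  exact ζ.2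

theorem norm_rotation_sub_one (N : ℕ) (hN : 0 < N) :
    ‖(rotation N : ℂ) - 1‖ = 2 * Real.sin (Real.pi / N) := by
  rw [rotation, Circle.coe_exp]
  have h := Complex.norm_exp_I_mul_ofReal_sub_one (2 * Real.pi / N)
  rw [mul_comm] at h
  rw [h]
  have h1 : 2 * Real.pi / N / 2 = Real.pi / N := by ring
  rw [h1, Real.norm_of_nonneg]
  have : 0 ≤ Real.sin (Real.pi / N) := by
    apply Real.sin_nonneg_of_nonneg_of_le_pi (by positivity)
    exact div_le_self Real.pi_pos.le (by exact_mod_cast hN)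
  positivity

theorem orderOf_le_card_rotationGroup (Γ : Subgroup PU21) [DiscreteTopology Γ] {A : PU21}
    (hA : A ∈ Γ) {c : Fin 3 → ℂ} (hAc : IsComplexReflection A c) (hc : herm c c ≠ 0) :
    orderOf A ≤ Nat.card (rotationGroup Γ c hc) := by
  have := finite_rotationGroup Γ c hc
  obtain ⟨hpos, g, rfl, a, b, -, ha, -⟩ := hAc
  obtain ⟨ζ, hζ⟩ := exists_mk_eq_mk_refl hpos ha
  have hζ' : (QuotientGroup.mk g : PU21) = mkReflHom c hc ζ := hζ
  rw [hζ', orderOf_injective _ (mkReflHom_injective c hc)]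
  have hmem : ζ ∈ rotationGroup Γ c hc := by
    change mkReflHom c hc ζ ∈ Γ
    rwa [← hζ']
  exact Subgroup.orderOf_le_card _ (Set.toFinite _) hmem

/-! ### Tubes around complex lines -/

/-- The tubular neighbourhood of the complex line polar to `c` given by `sinh² (ρ / 2) < S`, where
`ρ` is the distance to the line. -/
def tube (S : ℝ) (c : Fin 3 → ℂ) : Set H2 :=
  {z | ‖herm (lift z.1) c‖ ^ 2 < S * (herm c c).re * -(herm (lift z.1) (lift z.1)).re}

theorem mem_tube_smul_iff (S : ℝ) (c : Fin 3 → ℂ) (g : U21) (z : H2) :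
    g⁻¹ • z ∈ tube S c ↔ z ∈ tube S (g.val.val.mulVec c) := by
  obtain ⟨a, ha, h⟩ := lift_inv_smul g z
  simp only [tube, Set.mem_ofPred_eq]
  rw [h, herm_smul_left, herm_inv_mulVec, herm_smul_smul_re, g.2, (g⁻¹).2, norm_mul, mul_pow]
  have ha2 : 0 < ‖a‖ ^ 2 := by positivity
  rw [show S * (herm c c).re * -(‖a‖ ^ 2 * (herm (lift z.1) (lift z.1)).re)
    = ‖a‖ ^ 2 * (S * (herm c c).re * -(herm (lift z.1) (lift z.1)).re) by ring]
  exact mul_lt_mul_iff_right₀ ha2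

/-- Split `c` and `d` along the lift `Z` of the common point and its complement, where the form is
positive definite. The components along `Z` contribute at most `S h` to `|⟨c,d⟩|`. The orthogonal
components have norm less than `(1 + S) h`, so Cauchy-Schwarz bounds their contribution.
Geometrically, `1 + 2S = cosh ρ`. -/
theorem norm_herm_lt_of_mem_tube {S h : ℝ} (hh : 0 < h) {c d : Fin 3 → ℂ}
    (hc : (herm c c).re = h) (hd : (herm d d).re = h) {z : H2} (hzc : z ∈ tube S c)
    (hzd : z ∈ tube S d) : ‖herm c d‖ < (1 + 2 * S) * h := by
  simp only [tube, Set.mem_ofPred_eq, hc, hd] at hzc hzd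
  set Z := lift z.1
  have hZ := lift_neg z
  rw [norm_herm_comm] at hzc hzd
  set q := -(herm Z Z).re with hq
  have hq0 : 0 < q := by linarith
  have hqc : (q : ℂ) ≠ 0 := by exact_mod_cast hq0.ne'
  have hZq : herm Z Z = -(q : ℂ) := by rw [herm_self, hq]; push_cast; ring
  -- The projection to the complement of `Z`. The sign is a plus because `⟨Z,Z⟩ = -q`.
  let u : (Fin 3 → ℂ) → (Fin 3 → ℂ) := fun x => x + (herm x Z / q) • Z
  have hu : ∀ x, herm (u x) Z = 0 := by
    intro x
    simp only [u, herm_add_left, herm_smul_left, hZq]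
    field_simp
    ring
  have huv : ∀ x y, herm (u x) (u y) = herm x y + herm x Z * starRingEnd ℂ (herm y Z) / q := by
    intro x y
    have h1 : herm (u x) (u y) = herm (u x) y := by
      change herm (u x) (y + (herm y Z / q) • Z) = _
      rw [herm_add_right, herm_smul_right, hu, mul_zero, add_zero]
    rw [h1]
    simp only [u, herm_add_left, herm_smul_left, conj_herm]
    ring
  have huu : ∀ x, (herm (u x) (u x)).re = (herm x x).re + ‖herm x Z‖ ^ 2 / q := by
    intro x
    rw [huv, Complex.add_re, Complex.mul_conj', ← Complex.ofReal_pow, ← Complex.ofReal_div,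
      Complex.ofReal_re]
  have hCS := herm_cauchy_schwarz hZ (hu c) (hu d)
  rw [huu, huu, hc, hd] at hCS
  have h1 : ‖herm c Z‖ ^ 2 / q < S * h := by rwa [div_lt_iff₀ hq0]
  have h2 : ‖herm d Z‖ ^ 2 / q < S * h := by rwa [div_lt_iff₀ hq0]
  have h3 : ‖herm (u c) (u d)‖ < h + S * h := by
    have hn := norm_nonneg (herm (u c) (u d))
    have hp1 : 0 ≤ ‖herm c Z‖ ^ 2 / q := by positivity
    have hp2 : 0 ≤ ‖herm d Z‖ ^ 2 / q := by positivity
    refine lt_of_pow_lt_pow_left₀ 2 (by linarith) (hCS.trans_lt ?_)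
    rw [sq (h + S * h)]
    exact mul_lt_mul'' (by linarith) (by linarith) (by linarith) (by linarith)
  have h4 : ‖herm c Z * starRingEnd ℂ (herm d Z) / q‖ ≤ S * h := by
    rw [norm_div, norm_mul, Complex.norm_conj, Complex.norm_real, Real.norm_of_nonneg hq0.le,
      div_le_iff₀ hq0]
    rw [div_lt_iff₀ hq0] at h1 h2
    nlinarith [sq_nonneg (‖herm c Z‖ - ‖herm d Z‖)]
  have h5 : herm c d = herm (u c) (u d) - herm c Z * starRingEnd ℂ (herm d Z) / q := by
    rw [huv]; ring
  rw [h5]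
  refine (norm_sub_le _ _).trans_lt ?_
  linarith

/-- The orthogonal projection to the complex line polar to `c`. -/
def proj (c : Fin 3 → ℂ) (hc : 0 < (herm c c).re) (z : H2) : H2 :=
  mkPt _ (proj_neg hc (lift_neg z))

theorem mkPt_eq_mkPt {x y : Fin 3 → ℂ} (hx : (herm x x).re < 0) (hy : (herm y y).re < 0) {a : ℂ}
    (h : x = a • y) : mkPt x hx = mkPt y hy := by
  have ha : a ≠ 0 := by
    rintro rfl
    simp [h, herm] at hx
  apply Subtype.ext
  change dehom x = dehom y
  rw [h, dehom_smul ha]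

theorem proj_smul (g : U21) (c : Fin 3 → ℂ) (hc : 0 < (herm c c).re) (z : H2) :
    proj (g.val.val.mulVec c) (by rwa [g.2]) (g • z) = g • proj c hc z := by
  rw [proj, proj, smul_mkPt]
  refine mkPt_eq_mkPt _ _ (a := (g.val.val.mulVec (lift z.1) 2)⁻¹) ?_
  rw [lift_smul, herm_smul_left, g.2, g.2, Matrix.mulVec_sub, Matrix.mulVec_smul, smul_sub,
    smul_smul, mul_div_assoc]

theorem proj_congr {c d : Fin 3 → ℂ} (hc : 0 < (herm c c).re) (hd : 0 < (herm d d).re) {a : ℂ}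
    (h : d = a • c) (z : H2) : proj d hd z = proj c hc z := by
  subst h
  have ha : a ≠ 0 := by
    rintro rfl
    simp [herm] at hd
  have ha' : starRingEnd ℂ a ≠ 0 := by simpa using ha
  have hc' := herm_self_ne_zero hc
  refine mkPt_eq_mkPt _ _ (a := 1) ?_
  rw [one_smul, herm_smul_right, herm_smul_left, herm_smul_right, smul_smul]
  congr 2
  field_simp

/-- The part of the tube over a subset of its axis. -/
def tubeOver (S : ℝ) (c : Fin 3 → ℂ) (hc : 0 < (herm c c).re) (B : Set H2) : Set H2 :=
  {z | z ∈ tube S c ∧ proj c hc z ∈ B}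

/-- The upper bound on `|⟨g₂c,g₁c⟩|` from the common point contradicts the third alternative of
`jorgensen_inequality` applied to `g₁⁻¹g₂`. -/
theorem parallel_or_orthogonal_of_mem_tube (Γ : Subgroup PU21) [DiscreteTopology Γ] {ζ : Circle}
    (hζ1 : (ζ : ℂ) ≠ 1) (hζ : ‖(ζ : ℂ) - 1‖ < 1) {c : Fin 3 → ℂ} (hc : 0 < (herm c c).re)
    (hR : ζ ∈ rotationGroup Γ c (herm_self_ne_zero hc)) {S : ℝ}
    (hS : ‖(ζ : ℂ) - 1‖ * (1 + 2 * S) ≤ 1) {g₁ g₂ : U21} (h₁ : QuotientGroup.mk g₁ ∈ Γ)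
    (h₂ : QuotientGroup.mk g₂ ∈ Γ) {z : H2} (hz₁ : z ∈ tube S (g₁.val.val.mulVec c))
    (hz₂ : z ∈ tube S (g₂.val.val.mulVec c)) :
    (∃ a : ℂ, g₂.val.val.mulVec c = a • g₁.val.val.mulVec c) ∨
      herm (g₂.val.val.mulVec c) (g₁.val.val.mulVec c) = 0 := by
  have hmem : (QuotientGroup.mk (g₁⁻¹ * g₂) : PU21) ∈ Γ := by
    rw [QuotientGroup.mk_mul, QuotientGroup.mk_inv]
    exact Γ.mul_mem (Γ.inv_mem h₁) h₂
  have hlt := norm_herm_lt_of_mem_tube hc (by rw [g₂.2]) (by rw [g₁.2]) hz₂ hz₁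
  rcases jorgensen_inequality Γ hζ1 hζ (herm_self_ne_zero hc) hR hmem with ⟨a, ha⟩ | h0 | hle
  · left
    refine ⟨a, ?_⟩
    rw [← Matrix.mulVec_smul, ← ha, mul_mulVec, mulVec_inv_mulVec]
  · right
    rwa [mul_mulVec, herm_inv_mulVec] at h0
  · exfalso
    rw [mul_mulVec, herm_inv_mulVec, herm_self c, Complex.norm_real,
      Real.norm_of_nonneg hc.le] at hle
    have h1 : 0 < ‖(ζ : ℂ) - 1‖ := norm_pos_iff.2 (sub_ne_zero.2 hζ1)
    nlinarith [mul_lt_mul_of_pos_left hlt h1]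

/-! ### Counting the translates of a piece of tube through a point -/

/-- The elements of `Γ` carrying a point of `E` to `z`. -/
def returnSet (Γ : Subgroup PU21) (E : Set H2) (z : H2) : Set PU21 :=
  {γ | γ ∈ Γ ∧ γ⁻¹ • z ∈ E}

section Count

variable (Γ : Subgroup PU21) {c : Fin 3 → ℂ} (hc : 0 < (herm c c).re) {B : Set H2} {S : ℝ}

theorem mem_tube_of_mem_returnSet {g : U21} {z : H2}
    (h : (QuotientGroup.mk g : PU21) ∈ returnSet Γ (tubeOver S c hc B) z) :
    z ∈ tube S (g.val.val.mulVec c) :=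
  (mem_tube_smul_iff S c g z).1 h.2.1

/-- The element `g₁⁻¹g₂` preserves the line and carries the projection of `g₂⁻¹z` to that of
`g₁⁻¹z`. Both projections lie in `B`, so by hypothesis the element fixes the line pointwise and is
therefore a reflection about it. -/
theorem exists_rotation_of_parallel
    (hB : ∀ γ ∈ Γ, γ • complexLine c = complexLine c → ∀ w ∈ B, γ • w ∈ B →
      ∀ z ∈ complexLine c, γ • z = z) {g₁ g₂ : U21} {z : H2}
    (h₁ : (QuotientGroup.mk g₁ : PU21) ∈ returnSet Γ (tubeOver S c hc B) z)
    (h₂ : (QuotientGroup.mk g₂ : PU21) ∈ returnSet Γ (tubeOver S c hc B) z) {a : ℂ}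
    (ha : g₂.val.val.mulVec c = a • g₁.val.val.mulVec c) :
    ∃ ζ ∈ rotationGroup Γ c (herm_self_ne_zero hc),
      (QuotientGroup.mk g₂ : PU21)
        = QuotientGroup.mk g₁ * mkReflHom c (herm_self_ne_zero hc) ζ := by
  have hgc : (g₁⁻¹ * g₂).val.val.mulVec c = a • c := by
    rw [mul_mulVec, ha, Matrix.mulVec_smul, inv_mulVec_mulVec]
  have ha0 : a ≠ 0 := by
    rintro rfl
    rw [zero_smul] at hgc
    refine mulVec_ne_zero _ ?_ hgc
    rintro rfl
    simp [herm] at hc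
  have hmem : (QuotientGroup.mk (g₁⁻¹ * g₂) : PU21) ∈ Γ := by
    rw [QuotientGroup.mk_mul, QuotientGroup.mk_inv]
    exact Γ.mul_mem (Γ.inv_mem h₁.1) h₂.1
  have hline : (QuotientGroup.mk (g₁⁻¹ * g₂) : PU21) • complexLine c = complexLine c := by
    rw [smul_complexLine, hgc]
    ext w
    simp [complexLine, herm_smul_right, ha0]
  have hproj : (QuotientGroup.mk (g₁⁻¹ * g₂) : PU21) • proj c hc ((QuotientGroup.mk g₂ : PU21)⁻¹ • z)
      = proj c hc ((QuotientGroup.mk g₁ : PU21)⁻¹ • z) := by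
    rw [mk_smul, ← proj_smul, proj_congr hc _ hgc, ← mk_smul, smul_smul]
    congr 2
    rw [QuotientGroup.mk_mul, QuotientGroup.mk_inv, mul_inv_cancel_right]
  have hfix := hB _ hmem hline _ h₂.2.2 (by rw [hproj]; exact h₁.2.2)
  obtain ⟨ζ, hζ⟩ := exists_mk_eq_mk_refl_of_fixes hc hfix
  have hζ' : (QuotientGroup.mk (g₁⁻¹ * g₂) : PU21) = mkReflHom c (herm_self_ne_zero hc) ζ := hζ
  refine ⟨ζ, ?_, ?_⟩
  · change mkReflHom c (herm_self_ne_zero hc) ζ ∈ Γ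
    rwa [← hζ']
  · rw [← hζ', QuotientGroup.mk_mul, QuotientGroup.mk_inv, mul_inv_cancel_left]

/-- The left translate of the rotations of `Γ` about the line polar to `c`. -/
def rotationCoset (γ : PU21) : Set PU21 :=
  (fun ζ => γ * mkReflHom c (herm_self_ne_zero hc) ζ) ''
    (rotationGroup Γ c (herm_self_ne_zero hc) : Set Circle)

theorem encard_rotationCoset_le [DiscreteTopology Γ] (γ : PU21) :
    (rotationCoset Γ hc γ).encard ≤ Nat.card (rotationGroup Γ c (herm_self_ne_zero hc)) := by
  have := finite_rotationGroup Γ c (herm_self_ne_zero hc)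
  refine (Set.encard_image_le _ _).trans ?_
  rw [← ENat.card_eq_coe_natCard]
  exact le_rfl

variable [DiscreteTopology Γ] {ζ : Circle} (hζ1 : (ζ : ℂ) ≠ 1) (hζ : ‖(ζ : ℂ) - 1‖ < 1)
  (hR : ζ ∈ rotationGroup Γ c (herm_self_ne_zero hc)) (hS : ‖(ζ : ℂ) - 1‖ * (1 + 2 * S) ≤ 1)
  (hB : ∀ γ ∈ Γ, γ • complexLine c = complexLine c → ∀ w ∈ B, γ • w ∈ B →
      ∀ z ∈ complexLine c, γ • z = z)

include hζ1 hζ hR hS hB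

theorem mem_rotationCoset_or_orthogonal {g₁ g₂ : U21} {z : H2}
    (h₁ : (QuotientGroup.mk g₁ : PU21) ∈ returnSet Γ (tubeOver S c hc B) z)
    (h₂ : (QuotientGroup.mk g₂ : PU21) ∈ returnSet Γ (tubeOver S c hc B) z) :
    (QuotientGroup.mk g₂ : PU21) ∈ rotationCoset Γ hc (QuotientGroup.mk g₁) ∨
      herm (g₂.val.val.mulVec c) (g₁.val.val.mulVec c) = 0 := by
  rcases parallel_or_orthogonal_of_mem_tube Γ hζ1 hζ hc hR hS h₁.1 h₂.1
    (mem_tube_of_mem_returnSet Γ hc h₁) (mem_tube_of_mem_returnSet Γ hc h₂) with ⟨a, ha⟩ | h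
  · obtain ⟨ξ, hξ, h⟩ := exists_rotation_of_parallel Γ hc hB h₁ h₂ ha
    exact Or.inl ⟨ξ, hξ, h.symm⟩
  · exact Or.inr h

/-- Every point lies in the tubes around at most two lines of an orbit. -/
theorem encard_returnSet_le (z : H2) :
    (returnSet Γ (tubeOver S c hc B) z).encard
      ≤ ((2 * Nat.card (rotationGroup Γ c (herm_self_ne_zero hc)) : ℕ) : ℕ∞) := by
  rcases Set.eq_empty_or_nonempty (returnSet Γ (tubeOver S c hc B) z) with h | ⟨γ₁, h₁⟩
  · rw [h, Set.encard_empty]; exact zero_le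
  obtain ⟨g₁, rfl⟩ := QuotientGroup.mk_surjective γ₁
  have key := fun {g₁ g₂ : U21} => mem_rotationCoset_or_orthogonal Γ hc hζ1 hζ hR hS hB
    (g₁ := g₁) (g₂ := g₂) (z := z)
  have hcard := encard_rotationCoset_le Γ hc
  by_cases hall : returnSet Γ (tubeOver S c hc B) z ⊆ rotationCoset Γ hc (QuotientGroup.mk g₁)
  · refine ((Set.encard_le_encard hall).trans (hcard _)).trans ?_
    exact_mod_cast Nat.le_mul_of_pos_left _ two_pos
  obtain ⟨γ₂, h₂, hn₂⟩ := Set.not_subset.1 hall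
  obtain ⟨g₂, rfl⟩ := QuotientGroup.mk_surjective γ₂
  have hsub : returnSet Γ (tubeOver S c hc B) z
      ⊆ rotationCoset Γ hc (QuotientGroup.mk g₁) ∪ rotationCoset Γ hc (QuotientGroup.mk g₂) := by
    intro γ₃ h₃
    obtain ⟨g₃, rfl⟩ := QuotientGroup.mk_surjective γ₃
    rcases key h₁ h₃ with h | h31
    · exact Or.inl h
    rcases key h₂ h₃ with h | h32
    · exact Or.inr h
    -- A third element outside both cosets would give three pairwise orthogonal positive vectors.
    exact (not_three_orthogonal (by rwa [g₃.2]) (by rwa [g₂.2]) (by rwa [g₁.2]) h32 h31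
      ((key h₁ h₂).resolve_left hn₂)).elim
  refine ((Set.encard_le_encard hsub).trans (Set.encard_union_le _ _)).trans ?_
  rw [two_mul]
  push_cast
  exact add_le_add (hcard _) (hcard _)

/-- Every point lies in the tube around at most one line of an orbit without orthogonal lines. -/
theorem encard_returnSet_le_of_not_orthogonal
    (hno : ¬ ∃ g ∈ Γ, OrthogonalLines (g • complexLine c) (complexLine c)) (z : H2) :
    (returnSet Γ (tubeOver S c hc B) z).encard
      ≤ (Nat.card (rotationGroup Γ c (herm_self_ne_zero hc)) : ℕ∞) := by
  rcases Set.eq_empty_or_nonempty (returnSet Γ (tubeOver S c hc B) z) with h | ⟨γ₁, h₁⟩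
  · rw [h, Set.encard_empty]; exact zero_le
  obtain ⟨g₁, rfl⟩ := QuotientGroup.mk_surjective γ₁
  refine (Set.encard_le_encard ?_).trans (encard_rotationCoset_le Γ hc (QuotientGroup.mk g₁))
  intro γ₂ h₂
  obtain ⟨g₂, rfl⟩ := QuotientGroup.mk_surjective γ₂
  refine (mem_rotationCoset_or_orthogonal Γ hc hζ1 hζ hR hS hB h₁ h₂).resolve_right fun h => hno ?_
  refine ⟨QuotientGroup.mk (g₁⁻¹ * g₂), ?_, (g₁⁻¹ * g₂).val.val.mulVec c, c, ?_, hc, ?_, rfl, ?_⟩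
  · rw [QuotientGroup.mk_mul, QuotientGroup.mk_inv]
    exact Γ.mul_mem (Γ.inv_mem h₁.1) h₂.1
  · rwa [(g₁⁻¹ * g₂).2]
  · exact smul_complexLine _ _
  · rwa [mul_mulVec, herm_inv_mulVec]

end Count

/-! ### The induced transformation group and unfolding over a fundamental domain -/

theorem continuous_lift : Continuous lift := by
  unfold lift
  fun_prop

theorem continuous_smul_H2 (g : U21) : Continuous fun z : H2 => g • z := by
  have h : Continuous fun z : H2 => g.val.val.mulVec (lift z.1) :=
    continuous_const.matrix_mulVec (continuous_lift.comp continuous_subtype_val)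
  have h' : ∀ i, Continuous fun z : H2 => g.val.val.mulVec (lift z.1) i :=
    fun i => (continuous_apply i).comp h
  have h2 : ∀ z : H2, g.val.val.mulVec (lift z.1) 2 ≠ 0 :=
    fun z => coord_ne_zero (herm_image_neg g z)
  exact (((h' 0).div (h' 2) h2).prodMk ((h' 1).div (h' 2) h2)).subtype_mk _

instance : ContinuousConstSMul PU21 H2 where
  continuous_const_smul γ := by
    obtain ⟨g, rfl⟩ := QuotientGroup.mk_surjective γ
    exact continuous_smul_H2 g

/-- The group of transformations of the complex hyperbolic plane induced by `Γ`. -/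
abbrev permGroup (Γ : Subgroup PU21) : Subgroup (Equiv.Perm H2) :=
  (MulAction.toPermHom Γ H2).range

theorem permGroup_exists (Γ : Subgroup PU21) (σ : permGroup Γ) :
    ∃ γ ∈ Γ, ∀ z : H2, σ • z = γ • z := by
  obtain ⟨σ, ⟨γ, rfl⟩⟩ := σ
  exact ⟨γ, γ.2, fun z => rfl⟩

instance (Γ : Subgroup PU21) : ContinuousConstSMul (permGroup Γ) H2 where
  continuous_const_smul σ := by
    obtain ⟨γ, -, h⟩ := permGroup_exists Γ σ
    simp only [h]
    exact continuous_const_smul γ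

instance : BorelSpace H2 := Subtype.borelSpace _

instance (Γ : Subgroup PU21) : MeasurableConstSMul (permGroup Γ) H2 where
  measurable_const_smul σ := (continuous_const_smul σ).measurable

/-- Covolumes refer to the group of induced transformations. Distinct transformations have distinct
lifts to `Γ`, so a count in `Γ` bounds the count there. -/
theorem encard_permGroup_le (Γ : Subgroup PU21) (E : Set H2) (z : H2) :
    {σ : permGroup Γ | z ∈ σ • E}.encard ≤ (returnSet Γ E z).encard := by
  choose f hf using permGroup_exists Γ
  have hinj : Function.Injective f := by
    intro σ τ h
    apply Subtype.ext
    ext1 w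
    change σ • w = τ • w
    rw [(hf σ).2, (hf τ).2, h]
  refine Set.encard_le_encard_of_injOn (f := f) ?_ hinj.injOn
  intro σ hσ
  refine ⟨(hf σ).1, ?_⟩
  have h1 := Set.mem_smul_set_iff_inv_smul_mem.1 hσ
  have h2 : σ⁻¹ • z = (f σ)⁻¹ • z := by
    rw [inv_smul_eq_iff, (hf σ).2, smul_inv_smul]
  rwa [← h2]

/-- A set meeting each orbit at most `M` times, counted with multiplicity, has at most `M` times
the measure of a fundamental domain. -/
theorem measure_le_of_encard_returnSet_le (Γ : Subgroup PU21) [Countable (permGroup Γ)]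
    {μ : Measure H2} [SMulInvariantMeasure (permGroup Γ) H2 μ] {F : Set H2}
    (hF : IsFundamentalDomain (permGroup Γ) F μ) {E : Set H2} (hE : MeasurableSet E) {M : ℕ}
    (hM : ∀ z, (returnSet Γ E z).encard ≤ (M : ℕ∞)) : μ E ≤ M * μ F := by
  have h1 : ∀ σ : permGroup Γ, MeasurableSet (σ • E) := fun σ => hE.const_smul σ
  have h2 : ∀ z, ∑' σ : permGroup Γ, (σ • E).indicator (1 : H2 → ℝ≥0∞) z ≤ M := by
    intro z
    have h3 : ∀ σ : permGroup Γ, (σ • E).indicator (1 : H2 → ℝ≥0∞) z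
        = {σ : permGroup Γ | z ∈ σ • E}.indicator (fun _ => 1) σ := fun σ => rfl
    simp only [h3]
    rw [← tsum_subtype, ENNReal.tsum_set_one]
    exact_mod_cast (encard_permGroup_le Γ E z).trans (hM z)
  -- Distribute `E` over the translates of `F`, interchange sum and integral, and bound the number
  -- of translates of `E` through each point.
  calc μ E = ∑' σ : permGroup Γ, μ (σ • E ∩ F) := hF.measure_eq_tsum E
    _ = ∑' σ : permGroup Γ, ∫⁻ z in F, (σ • E).indicator 1 z ∂μ := by
        congr 1 with σ
        rw [lintegral_indicator_one (h1 σ), Measure.restrict_apply (h1 σ)]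
    _ = ∫⁻ z in F, ∑' σ : permGroup Γ, (σ • E).indicator 1 z ∂μ := by
        rw [lintegral_tsum]
        exact fun σ => (measurable_one.indicator (h1 σ)).aemeasurable
    _ ≤ ∫⁻ _ in F, (M : ℝ≥0∞) ∂μ := lintegral_mono h2
    _ = M * μ F := by rw [lintegral_const, Measure.restrict_apply_univ]

/-! ### The density of the volume -/

/-- The function `1 - |z|²`. -/
def height (z : ℂ × ℂ) : ℝ := 1 - Complex.normSq z.1 - Complex.normSq z.2

theorem herm_lift_re (z : ℂ × ℂ) : (herm (lift z) (lift z)).re = -height z := by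
  rw [herm_self_re]
  simp [lift, height]
  ring

theorem metric_eq (z v w : ℂ × ℂ) : metric z v w = 4 / height z ^ 2 *
    (height z * (v.1 * starRingEnd ℂ w.1 + v.2 * starRingEnd ℂ w.2).re +
      ((v.1 * starRingEnd ℂ z.1 + v.2 * starRingEnd ℂ z.2) *
        (z.1 * starRingEnd ℂ w.1 + z.2 * starRingEnd ℂ w.2)).re) := by
  have h1 : herm ![v.1, v.2, 0] ![w.1, w.2, 0]
      = v.1 * starRingEnd ℂ w.1 + v.2 * starRingEnd ℂ w.2 := by simp [herm]
  have h2 : herm ![v.1, v.2, 0] (lift z)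
      = v.1 * starRingEnd ℂ z.1 + v.2 * starRingEnd ℂ z.2 := by simp [herm, lift]
  have h3 : herm (lift z) ![w.1, w.2, 0]
      = z.1 * starRingEnd ℂ w.1 + z.2 * starRingEnd ℂ w.2 := by simp [herm, lift]
  rw [metric, h1, h2, h3, herm_lift_re, herm_self (lift z), herm_lift_re, Complex.sub_re,
    Complex.re_ofReal_mul]
  ring

/-- This is the real form of a Hermitian `2 × 2` matrix with diagonal entries `kp`, `kq` and
off-diagonal entry of squared modulus `k²(r² + s²)`. Its determinant is the square of the complex
one. -/
theorem det_hermitian_four (k p q r s : ℝ) :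
    Matrix.det (Matrix.of ![![k * p, 0, k * r, k * s], ![0, k * p, -(k * s), k * r],
      ![k * r, -(k * s), k * q, 0], ![k * s, k * r, 0, k * q]])
      = (k ^ 2 * (p * q - r ^ 2 - s ^ 2)) ^ 2 := by
  simp [Matrix.det_succ_row_zero, Fin.sum_univ_succ, Fin.succAbove]
  ring

theorem gramDensity_standard {z : ℂ × ℂ} (hz : 0 < height z) :
    gramDensity z ![(1, 0), (Complex.I, 0), (0, 1), (0, Complex.I)] = 16 / height z ^ 3 := by
  have h : (Matrix.of fun i j => metric z
      ((![(1, 0), (Complex.I, 0), (0, 1), (0, Complex.I)] : Fin 4 → ℂ × ℂ) i)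
      ((![(1, 0), (Complex.I, 0), (0, 1), (0, Complex.I)] : Fin 4 → ℂ × ℂ) j))
      = Matrix.of ![![(4 / height z ^ 2) * (height z + Complex.normSq z.1), 0,
            (4 / height z ^ 2) * (z.1.re * z.2.re + z.1.im * z.2.im),
            (4 / height z ^ 2) * (z.1.re * z.2.im - z.1.im * z.2.re)],
          ![0, (4 / height z ^ 2) * (height z + Complex.normSq z.1),
            -((4 / height z ^ 2) * (z.1.re * z.2.im - z.1.im * z.2.re)),
            (4 / height z ^ 2) * (z.1.re * z.2.re + z.1.im * z.2.im)],
          ![(4 / height z ^ 2) * (z.1.re * z.2.re + z.1.im * z.2.im),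
            -((4 / height z ^ 2) * (z.1.re * z.2.im - z.1.im * z.2.re)),
            (4 / height z ^ 2) * (height z + Complex.normSq z.2), 0],
          ![(4 / height z ^ 2) * (z.1.re * z.2.im - z.1.im * z.2.re),
            (4 / height z ^ 2) * (z.1.re * z.2.re + z.1.im * z.2.im), 0,
            (4 / height z ^ 2) * (height z + Complex.normSq z.2)]] := by
    ext i j
    rw [Matrix.of_apply, metric_eq]
    fin_cases i <;> fin_cases j <;> simp [Complex.normSq_apply] <;> 
      first | (left; ring1) | (right; ring1) | ring1
  rw [gramDensity, h, det_hermitian_four, Real.sqrt_sq_eq_abs]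
  -- With `h = height z` the left side is `h(h + |z₁|² + |z₂|²)`, and the second factor is `1`.
  have h1 : (height z + Complex.normSq z.1) * (height z + Complex.normSq z.2)
      - (z.1.re * z.2.re + z.1.im * z.2.im) ^ 2 - (z.1.re * z.2.im - z.1.im * z.2.re) ^ 2
      = height z := by
    simp only [height, Complex.normSq_apply]
    ring
  rw [h1, abs_of_pos (by positivity)]
  field_simp
  norm_num

instance : (volume : Measure (ℂ × ℂ)).IsAddHaarMeasure :=
  inferInstanceAs ((volume : Measure ℂ).prod (volume : Measure ℂ)).IsAddHaarMeasure

/-! ### Change of variables under projective transformations -/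

/-- The projective transformation of the affine chart given by a matrix. -/
def chartMap (M : Matrix (Fin 3) (Fin 3) ℂ) (z : ℂ × ℂ) : ℂ × ℂ := dehom (M.mulVec (lift z))

theorem mulVec_lift (M : Matrix (Fin 3) (Fin 3) ℂ) (z : ℂ × ℂ) (i : Fin 3) :
    M.mulVec (lift z) i = M i 0 * z.1 + M i 1 * z.2 + M i 2 := by
  simp [Matrix.mulVec, dotProduct, Fin.sum_univ_three, lift]

/-- The matrix of the derivative of a projective transformation. -/
def chartDeriv (M : Matrix (Fin 3) (Fin 3) ℂ) (z : ℂ × ℂ) : Matrix (Fin 2) (Fin 2) ℂ :=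
  Matrix.of fun i j => (M i.castSucc j.castSucc * M.mulVec (lift z) 2
    - M.mulVec (lift z) i.castSucc * M 2 j.castSucc) / M.mulVec (lift z) 2 ^ 2

theorem det_chartDeriv (M : Matrix (Fin 3) (Fin 3) ℂ) {z : ℂ × ℂ}
    (hz : M.mulVec (lift z) 2 ≠ 0) :
    (chartDeriv M z).det = M.det / M.mulVec (lift z) 2 ^ 3 := by
  rw [Matrix.det_fin_two, Matrix.det_fin_three]
  simp only [chartDeriv, Matrix.of_apply]
  field_simp
  simp only [mulVec_lift, Fin.castSucc_zero, Fin.castSucc_one]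
  ring

/-- The derivative of a projective transformation, as a complex linear map. -/
def chartFDeriv (M : Matrix (Fin 3) (Fin 3) ℂ) (z : ℂ × ℂ) : ℂ × ℂ →L[ℂ] ℂ × ℂ :=
  LinearMap.toContinuousLinearMap
    (Matrix.toLin (Module.Basis.finTwoProd ℂ) (Module.Basis.finTwoProd ℂ) (chartDeriv M z))

theorem hasFDerivAt_chartMap (M : Matrix (Fin 3) (Fin 3) ℂ) {z : ℂ × ℂ}
    (hz : M.mulVec (lift z) 2 ≠ 0) : HasFDerivAt (chartMap M) (chartFDeriv M z) z := by
  have hN : ∀ i, HasFDerivAt (fun z => M.mulVec (lift z) i)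
      (M i 0 • ContinuousLinearMap.fst ℂ ℂ ℂ + M i 1 • ContinuousLinearMap.snd ℂ ℂ ℂ) z := by
    intro i
    simp only [mulVec_lift]
    exact ((hasFDerivAt_fst.const_mul _).add (hasFDerivAt_snd.const_mul _)).add_const _
  have hinv := (hasDerivAt_inv hz).comp_hasFDerivAt z (hN 2)
  have h := ((hN 0).mul hinv).prodMk ((hN 1).mul hinv)
  have hf : chartMap M = fun z => (M.mulVec (lift z) 0 * (M.mulVec (lift z) 2)⁻¹,
      M.mulVec (lift z) 1 * (M.mulVec (lift z) 2)⁻¹) := by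
    funext z
    simp [chartMap, dehom, div_eq_mul_inv]
  rw [hf]
  refine h.congr_fderiv ?_
  ext <;> simp [chartFDeriv, chartDeriv, Matrix.toLin_apply,
    Matrix.mulVec, dotProduct] <;> field_simp <;> ring

/-- The real determinant of a complex linear map is the squared modulus of its complex determinant.
-/
theorem det_restrictScalars_chartFDeriv (M : Matrix (Fin 3) (Fin 3) ℂ) {z : ℂ × ℂ}
    (hz : M.mulVec (lift z) 2 ≠ 0) :
    ((chartFDeriv M z).restrictScalars ℝ).det
      = Complex.normSq M.det / Complex.normSq (M.mulVec (lift z) 2) ^ 3 := by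
  have h : ((chartFDeriv M z).restrictScalars ℝ).det
      = LinearMap.det ((chartFDeriv M z).toLinearMap.restrictScalars ℝ) := rfl
  rw [h, LinearMap.det_restrictScalars, Algebra.norm_complex_apply, chartFDeriv]
  rw [LinearMap.coe_toContinuousLinearMap, LinearMap.det_toLin, det_chartDeriv M hz,
    Complex.normSq_div, map_pow]

theorem chartMap_injOn {M : Matrix (Fin 3) (Fin 3) ℂ} (hM : M.det ≠ 0) {E : Set (ℂ × ℂ)}
    (hE : ∀ z ∈ E, M.mulVec (lift z) 2 ≠ 0) : Set.InjOn (chartMap M) E := by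
  intro z hz w hw h
  have h1 : lift (dehom (M.mulVec (lift z))) = lift (dehom (M.mulVec (lift w))) :=
    congrArg lift h
  rw [lift_dehom (hE z hz), lift_dehom (hE w hw), ← Matrix.mulVec_smul, ← Matrix.mulVec_smul] at h1
  have h2 := Matrix.mulVec_injective_of_isUnit
    ((Matrix.isUnit_iff_isUnit_det _).2 (isUnit_iff_ne_zero.2 hM)) h1
  have h3 := congrArg dehom h2
  rwa [dehom_smul (inv_ne_zero (hE z hz)), dehom_smul (inv_ne_zero (hE w hw)), dehom_lift,
    dehom_lift] at h3

theorem lintegral_image_chartMap {M : Matrix (Fin 3) (Fin 3) ℂ} (hM : M.det ≠ 0)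
    {E : Set (ℂ × ℂ)} (hEm : MeasurableSet E) (hE : ∀ z ∈ E, M.mulVec (lift z) 2 ≠ 0)
    (f : ℂ × ℂ → ℝ≥0∞) :
    ∫⁻ z in chartMap M '' E, f z = ∫⁻ z in E, ENNReal.ofReal
      (Complex.normSq M.det / Complex.normSq (M.mulVec (lift z) 2) ^ 3) * f (chartMap M z) := by
  rw [lintegral_image_eq_lintegral_abs_det_fderiv_mul volume hEm
    (fun z hz => ((hasFDerivAt_chartMap M (hE z hz)).restrictScalars ℝ).hasFDerivWithinAt)
    (chartMap_injOn hM hE)]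
  refine setLIntegral_congr_fun hEm fun z hz => ?_
  rw [det_restrictScalars_chartFDeriv M (hE z hz), abs_of_nonneg]
  have := Complex.normSq_nonneg M.det
  have := Complex.normSq_nonneg (M.mulVec (lift z) 2)
  positivity

/-! ### The invariance of the volume -/

theorem isOpen_ball : IsOpen {z : ℂ × ℂ | Complex.normSq z.1 + Complex.normSq z.2 < 1} := by
  refine isOpen_lt ?_ continuous_const
  exact (Complex.continuous_normSq.comp continuous_fst).add
    (Complex.continuous_normSq.comp continuous_snd)

theorem measurableEmbedding_coe_H2 : MeasurableEmbedding (Subtype.val : H2 → ℂ × ℂ) :=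
  MeasurableEmbedding.subtype_coe isOpen_ball.measurableSet

theorem height_pos (z : H2) : 0 < height z.1 := by
  have := z.2
  unfold height
  linarith

theorem continuous_height : Continuous height := by
  unfold height
  exact (continuous_const.sub (Complex.continuous_normSq.comp continuous_fst)).sub
    (Complex.continuous_normSq.comp continuous_snd)

/-- The volume of a set in terms of the explicit density in the ball model. -/
theorem hypVolume_apply {E : Set H2} (hE : MeasurableSet E) :
    hypVolume E = ∫⁻ z in Subtype.val '' E, ENNReal.ofReal (16 / height z ^ 3) := by
  have hE' := measurableEmbedding_coe_H2.measurableSet_image.2 hE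
  rw [hypVolume, measurableEmbedding_coe_H2.comap_apply, withDensity_apply _ hE']
  refine setLIntegral_congr_fun hE' ?_
  rintro _ ⟨z, -, rfl⟩
  simp only
  rw [gramDensity_standard (height_pos z)]

theorem height_chartMap {M : Matrix (Fin 3) (Fin 3) ℂ} {z : ℂ × ℂ}
    (hz : M.mulVec (lift z) 2 ≠ 0) :
    height (chartMap M z) = -(herm (M.mulVec (lift z)) (M.mulVec (lift z))).re
      / Complex.normSq (M.mulVec (lift z) 2) := by
  have h : (herm (lift (chartMap M z)) (lift (chartMap M z))).re
      = (herm (M.mulVec (lift z)) (M.mulVec (lift z))).re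
        / Complex.normSq (M.mulVec (lift z) 2) := by
    rw [chartMap, lift_dehom hz, herm_smul_smul_re, ← Complex.normSq_eq_norm_sq, Complex.normSq_inv]
    ring
  rw [herm_lift_re] at h
  rw [neg_div, ← h, neg_neg]

/-- The volume of a set parametrized by a projective transformation. -/
theorem hypVolume_image {M : Matrix (Fin 3) (Fin 3) ℂ} (hM : M.det ≠ 0) {E : Set (ℂ × ℂ)}
    (hE : MeasurableSet E)
    (hneg : ∀ z ∈ E, (herm (M.mulVec (lift z)) (M.mulVec (lift z))).re < 0) {V : Set H2}
    (hV : MeasurableSet V) (hVE : Subtype.val '' V = chartMap M '' E) :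
    hypVolume V = ∫⁻ z in E, ENNReal.ofReal (16 * Complex.normSq M.det /
      (-(herm (M.mulVec (lift z)) (M.mulVec (lift z))).re) ^ 3) := by
  have h2 : ∀ z ∈ E, M.mulVec (lift z) 2 ≠ 0 := fun z hz => coord_ne_zero (hneg z hz)
  rw [hypVolume_apply hV, hVE, lintegral_image_chartMap hM hE h2]
  refine setLIntegral_congr_fun hE fun z hz => ?_
  have h3 := Complex.normSq_pos.2 (h2 z hz)
  have h4 := Complex.normSq_nonneg M.det
  have h5 : 0 < -(herm (M.mulVec (lift z)) (M.mulVec (lift z))).re := by linarith [hneg z hz]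
  rw [← ENNReal.ofReal_mul (by positivity), height_chartMap (h2 z hz)]
  congr 1
  field_simp

theorem normSq_det_eq_one (g : U21) : Complex.normSq g.val.val.det = 1 := by
  have h := congrArg Matrix.det (preserves_iff.1 g.2)
  rw [Matrix.det_mul, Matrix.det_mul, Matrix.det_conjTranspose, det_J, Complex.star_def,
    mul_neg_one, neg_mul, neg_inj, mul_comm, Complex.mul_conj] at h
  exact_mod_cast h

/-- An isometry preserves the form and has determinant of modulus `1`, so the transformed density in
`hypVolume_image` is the original one. -/
theorem hypVolume_smul (γ : PU21) {E : Set H2} (hE : MeasurableSet E) :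
    hypVolume (γ • E) = hypVolume E := by
  obtain ⟨g, rfl⟩ := QuotientGroup.mk_surjective γ
  have hdet : g.val.val.det ≠ 0 := by
    intro h
    have := normSq_det_eq_one g
    simp [h] at this
  have hE' := measurableEmbedding_coe_H2.measurableSet_image.2 hE
  rw [hypVolume_image hdet hE' (V := (QuotientGroup.mk g : PU21) • E), hypVolume_apply hE]
  · refine setLIntegral_congr_fun hE' fun z hz => ?_
    rw [normSq_det_eq_one, g.2, herm_lift_re, neg_neg, mul_one]
  · rintro _ ⟨z, -, rfl⟩
    exact herm_image_neg g z
  · exact hE.const_smul _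
  · ext w
    constructor
    · rintro ⟨_, ⟨z, hz, rfl⟩, rfl⟩
      exact ⟨z.1, ⟨z, hz, rfl⟩, rfl⟩
    · rintro ⟨_, ⟨z, hz, rfl⟩, rfl⟩
      exact ⟨_, Set.smul_mem_smul_set hz, rfl⟩

instance (Γ : Subgroup PU21) : SMulInvariantMeasure (permGroup Γ) H2 hypVolume where
  measure_preimage_smul σ E hE := by
    obtain ⟨γ, -, h⟩ := permGroup_exists Γ σ
    have : (fun z => σ • z) ⁻¹' E = γ⁻¹ • E := by
      ext z
      rw [Set.mem_inv_smul_set_iff, ← h]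
      rfl
    rw [this, hypVolume_smul _ hE]

/-! ### The volume of a tube -/

theorem lintegral_radial {g : ℝ → ℝ≥0∞} (hg : Measurable g) :
    ∫⁻ s : ℂ, g ‖s‖ = ENNReal.ofReal (2 * Real.pi) *
      ∫⁻ r in Set.Ioi (0 : ℝ), ENNReal.ofReal r * g r := by
  rw [← Complex.lintegral_comp_polarCoord_symm]
  have h1 : ∫⁻ p in polarCoord.target, ENNReal.ofReal p.1 • g ‖Complex.polarCoord.symm p‖
      = ∫⁻ p in Set.Ioi (0 : ℝ) ×ˢ Set.Ioo (-Real.pi) Real.pi,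
        (ENNReal.ofReal p.1 * g p.1) * 1 := by
    refine setLIntegral_congr_fun (measurableSet_Ioi.prod measurableSet_Ioo) fun p hp => ?_
    have hp1 : 0 < p.1 := hp.1
    rw [Complex.norm_polarCoord_symm, abs_of_pos hp1, mul_one, smul_eq_mul]
  rw [h1, Measure.volume_eq_prod, ← Measure.prod_restrict,
    lintegral_prod_mul (f := fun r => ENNReal.ofReal r * g r) (g := fun _ => 1)
      (by fun_prop) (by fun_prop), lintegral_one, Measure.restrict_apply_univ, Real.volume_Ioo,
    mul_comm]
  congr 2
  ring

/-- The integral over one fibre of the tube, with `h = ⟨c,c⟩`, `P` the height of the base point on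
the line, and `s` the coordinate along `c`. The factor `4h/P²` is the area density of the line, so
the remaining factor does not depend on the base point. -/
theorem lintegral_disc {P h S : ℝ} (hP : 0 < P) (hh : 0 < h) (hS : 0 ≤ S) :
    ∫⁻ s : ℂ in {s | h * (1 + S) * ‖s‖ ^ 2 < S * P},
        ENNReal.ofReal (16 * h ^ 2 / (P - h * ‖s‖ ^ 2) ^ 3)
      = ENNReal.ofReal (2 * Real.pi * ((1 + S) ^ 2 - 1)) * ENNReal.ofReal (4 * h / P ^ 2) := by
  set R := Real.sqrt (S * P / (h * (1 + S))) with hR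
  have hR2 : R ^ 2 = S * P / (h * (1 + S)) := Real.sq_sqrt (by positivity)
  have hR0 : 0 ≤ R := Real.sqrt_nonneg _
  have hiff : ∀ r : ℝ, 0 ≤ r → (h * (1 + S) * r ^ 2 < S * P ↔ r < R) := by
    intro r hr
    rw [hR, Real.lt_sqrt hr, lt_div_iff₀ (by positivity), mul_comm]
  have hden : ∀ r ∈ Set.Icc 0 R, 0 < P - h * r ^ 2 := by
    intro r hr
    have h1 : r ^ 2 ≤ R ^ 2 := pow_le_pow_left₀ hr.1 hr.2 2
    rw [hR2, le_div_iff₀ (by positivity)] at h1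
    nlinarith
  let g : ℝ → ℝ≥0∞ := (Set.Iio R).indicator fun r => ENNReal.ofReal (16 * h ^ 2 / (P - h * r ^ 2) ^ 3)
  have hg : Measurable g := Measurable.indicator (by fun_prop) measurableSet_Iio
  have hmeas : MeasurableSet {s : ℂ | h * (1 + S) * ‖s‖ ^ 2 < S * P} :=
    (isOpen_lt (by fun_prop) continuous_const).measurableSet
  have h1 : ∫⁻ s : ℂ in {s | h * (1 + S) * ‖s‖ ^ 2 < S * P},
        ENNReal.ofReal (16 * h ^ 2 / (P - h * ‖s‖ ^ 2) ^ 3) = ∫⁻ s : ℂ, g ‖s‖ := by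
    rw [← lintegral_indicator hmeas]
    congr 1 with s
    simp only [g, Set.indicator_apply, Set.mem_Iio, Set.mem_ofPred_eq, hiff _ (norm_nonneg s)]
  have hint : ∫ r in (0 : ℝ)..R, r * (16 * h ^ 2 / (P - h * r ^ 2) ^ 3)
      = 4 * h * ((1 + S) ^ 2 - 1) / P ^ 2 := by
    -- A primitive is `4h (P - h r²)⁻²`. At the radius `R` of the disc, `P - h R² = P/(1 + S)`.
    have hderiv : ∀ r ∈ Set.uIcc 0 R, HasDerivAt (fun r : ℝ => 4 * h * ((P - h * r ^ 2) ^ 2)⁻¹)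
        (r * (16 * h ^ 2 / (P - h * r ^ 2) ^ 3)) r := by
      intro r hr
      rw [Set.uIcc_of_le hR0] at hr
      have hne := (hden r hr).ne'
      have h2 : HasDerivAt (fun r : ℝ => P - h * r ^ 2) (-(h * (2 * r))) r := by
        simpa using ((hasDerivAt_pow 2 r).const_mul h).const_sub P
      have h3 := ((h2.pow 2).inv (pow_ne_zero 2 hne)).const_mul (4 * h)
      refine h3.congr_deriv ?_
      simp only [Pi.pow_apply]
      field_simp
      ring
    rw [intervalIntegral.integral_eq_sub_of_hasDerivAt hderiv]
    · have h4 : P - h * R ^ 2 = P / (1 + S) := by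
        rw [hR2]
        field_simp
        ring
      have h4' : P - h * (0 : ℝ) ^ 2 = P := by ring
      rw [h4, h4']
      field_simp
    · apply ContinuousOn.intervalIntegrable
      rw [Set.uIcc_of_le hR0]
      exact continuousOn_id.mul (continuousOn_const.div (by fun_prop)
        fun r hr => pow_ne_zero 3 (hden r hr).ne')
  have h5 : ∫⁻ r in Set.Ioi (0 : ℝ), ENNReal.ofReal r * g r
      = ENNReal.ofReal (∫ r in (0 : ℝ)..R, r * (16 * h ^ 2 / (P - h * r ^ 2) ^ 3)) := by
    rw [intervalIntegral.integral_of_le hR0, integral_Ioc_eq_integral_Ioo,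
      ofReal_integral_eq_lintegral_ofReal]
    · rw [← lintegral_indicator measurableSet_Ioi, ← lintegral_indicator measurableSet_Ioo]
      congr 1 with r
      by_cases hr : 0 < r
      · by_cases hrR : r < R
        · simp [g, hr, hrR, ENNReal.ofReal_mul hr.le]
        · simp [g, hr, hrR]
      · simp [hr]
    · apply IntegrableOn.mono_set _ Set.Ioo_subset_Icc_self
      apply ContinuousOn.integrableOn_Icc
      exact continuousOn_id.mul (continuousOn_const.div (by fun_prop)
        fun r hr => pow_ne_zero 3 (hden r hr).ne')
    · filter_upwards [ae_restrict_mem measurableSet_Ioo] with r hr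
      have h6 := hden r ⟨hr.1.le, hr.2.le⟩
      have := hr.1
      positivity
  rw [h1, lintegral_radial hg, h5, hint, ← ENNReal.ofReal_mul (by positivity),
    ← ENNReal.ofReal_mul (by nlinarith [Real.pi_pos, mul_nonneg hS hS])]
  congr 1
  ring

/-! ### Coordinates adapted to a complex line -/

section Line

variable (c : Fin 3 → ℂ)

/-- The Euclidean norm of the first two coordinates of `c`, squared. -/
def planarNormSq : ℝ := Complex.normSq (c 0) + Complex.normSq (c 1)

/-- A matrix adapted to the complex line polar to `c`: it maps `(w, s, 1)` to the sum of `s c` and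
the lift of the point of the line with parameter `w`. -/
def lineMatrix : Matrix (Fin 3) (Fin 3) ℂ :=
  Matrix.of ![![-starRingEnd ℂ (c 1), c 0, starRingEnd ℂ (c 2) / planarNormSq c * c 0],
    ![starRingEnd ℂ (c 0), c 1, starRingEnd ℂ (c 2) / planarNormSq c * c 1], ![0, c 2, 1]]

theorem lineMatrix_mulVec (w s : ℂ) :
    (lineMatrix c).mulVec (lift (w, s)) = lift (linePoint c w) + s • c := by
  ext i
  rw [mulVec_lift]
  fin_cases i <;> simp [lineMatrix, linePoint, lineDir, lift, planarNormSq] <;> ring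

/-- Minus the norm of the lift of the point with parameter `w` of the complex line polar to `c`. -/
def lineHeight (w : ℂ) : ℝ :=
  (herm c c).re / planarNormSq c - planarNormSq c * ‖w‖ ^ 2

theorem planarNormSq_eq : (planarNormSq c : ℂ)
    = c 0 * starRingEnd ℂ (c 0) + c 1 * starRingEnd ℂ (c 1) := by
  rw [planarNormSq, Complex.mul_conj, Complex.mul_conj]
  push_cast
  rfl

theorem continuous_linePoint : Continuous (linePoint c) := by
  unfold linePoint
  fun_prop

theorem isClosed_complexLine : IsClosed (complexLine c) := by
  have : Continuous fun z : H2 => herm (lift z.1) c := by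
    have h := continuous_lift.comp (continuous_subtype_val (p := fun z : ℂ × ℂ =>
      Complex.normSq z.1 + Complex.normSq z.2 < 1))
    have h' := fun i => (continuous_apply i).comp h
    unfold herm
    exact (((h' 0).mul continuous_const).add ((h' 1).mul continuous_const)).sub
      ((h' 2).mul continuous_const)
  exact isClosed_eq this continuous_const

variable {c} (hc : 0 < (herm c c).re)
include hc

theorem planarNormSq_pos : 0 < planarNormSq c := by
  rw [herm_self_re] at hc
  unfold planarNormSq
  linarith [Complex.normSq_nonneg (c 2)]

theorem planarNormSq_ne_zero : (planarNormSq c : ℂ) ≠ 0 := by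
  exact_mod_cast (planarNormSq_pos hc).ne'

theorem det_lineMatrix : (lineMatrix c).det = -herm c c := by
  have h0 := planarNormSq_ne_zero hc
  rw [Matrix.det_fin_three]
  simp only [lineMatrix, Matrix.of_apply, Matrix.cons_val, herm]
  field_simp
  rw [planarNormSq_eq c]
  ring

theorem herm_linePoint (w : ℂ) : herm (lift (linePoint c w)) c = 0 := by
  have h0 := planarNormSq_ne_zero hc
  have h1 := planarNormSq_eq c
  have h2 : ((Complex.normSq (c 0) : ℂ) + (Complex.normSq (c 1) : ℂ)) = planarNormSq c := by
    simp [planarNormSq]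
  simp [herm, lift, linePoint, lineDir, h2]
  field_simp
  rw [h1]
  ring

theorem height_linePoint (w : ℂ) : height (linePoint c w) = lineHeight c w := by
  have h0 := planarNormSq_ne_zero hc
  have h1 := planarNormSq_eq c
  have h2 : ((Complex.normSq (c 0) : ℂ) + (Complex.normSq (c 1) : ℂ)) = planarNormSq c := by
    simp [planarNormSq]
  have h : (height (linePoint c w) : ℂ) = lineHeight c w := by
    rw [height, lineHeight]
    push_cast
    rw [← herm_self, ← Complex.mul_conj, ← Complex.mul_conj, ← Complex.mul_conj']
    simp only [linePoint, lineDir, Prod.fst_add, Prod.snd_add, Prod.smul_fst, Prod.smul_snd,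
      smul_eq_mul, h2, map_add, map_mul, map_div₀, map_neg, Complex.conj_conj, Complex.conj_ofReal,
      herm]
    field_simp
    rw [h1]
    ring
  exact_mod_cast h

/-- The direction `v` and `iv` are orthogonal and of equal length, so the area is the squared length
of `v`. -/
theorem gramDensity_line {w : ℂ} (hw : 0 < lineHeight c w) :
    gramDensity (linePoint c w) ![lineDir c, Complex.I • lineDir c]
      = 4 * (herm c c).re / lineHeight c w ^ 2 := by
  have hP := height_linePoint hc w
  have h0 := planarNormSq_pos hc
  have h0c := planarNormSq_ne_zero hc
  set z := linePoint c w with hz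
  set v := lineDir c with hv
  have hvv : v.1 * starRingEnd ℂ v.1 + v.2 * starRingEnd ℂ v.2 = planarNormSq c := by
    rw [planarNormSq_eq c]
    simp [hv, lineDir]
    ring
  have hvz : v.1 * starRingEnd ℂ z.1 + v.2 * starRingEnd ℂ z.2
      = starRingEnd ℂ w * planarNormSq c := by
    rw [planarNormSq_eq c]
    simp [hv, hz, linePoint, lineDir]
    ring
  have hzv : z.1 * starRingEnd ℂ v.1 + z.2 * starRingEnd ℂ v.2 = w * planarNormSq c := by
    have := congrArg (starRingEnd ℂ) hvz
    simp only [map_add, map_mul, Complex.conj_conj, Complex.conj_ofReal] at this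
    rw [← this]; ring
  have hmet : ∀ a b : ℂ, metric z (a • v) (b • v)
      = 4 * (herm c c).re / lineHeight c w ^ 2 * (a * starRingEnd ℂ b).re := by
    intro a b
    have e1 : (a • v).1 * starRingEnd ℂ (b • v).1 + (a • v).2 * starRingEnd ℂ (b • v).2
        = ((planarNormSq c : ℝ) : ℂ) * (a * starRingEnd ℂ b) := by
      rw [← hvv]
      simp
      ring
    have e2 : ((a • v).1 * starRingEnd ℂ z.1 + (a • v).2 * starRingEnd ℂ z.2) *
        (z.1 * starRingEnd ℂ (b • v).1 + z.2 * starRingEnd ℂ (b • v).2)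
        = ((planarNormSq c ^ 2 * ‖w‖ ^ 2 : ℝ) : ℂ) * (a * starRingEnd ℂ b) := by
      have e3 : ((a • v).1 * starRingEnd ℂ z.1 + (a • v).2 * starRingEnd ℂ z.2)
          = a * (starRingEnd ℂ w * planarNormSq c) := by
        rw [← hvz]
        simp
        ring
      have e4 : (z.1 * starRingEnd ℂ (b • v).1 + z.2 * starRingEnd ℂ (b • v).2)
          = starRingEnd ℂ b * (w * planarNormSq c) := by
        rw [← hzv]
        simp
        ring
      rw [e3, e4]
      push_cast
      rw [← Complex.conj_mul']
      ring
    rw [metric_eq, hP, e1, e2, Complex.re_ofReal_mul, Complex.re_ofReal_mul]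
    have e5 : (herm c c).re = lineHeight c w * planarNormSq c + planarNormSq c ^ 2 * ‖w‖ ^ 2 := by
      rw [lineHeight]
      field_simp
      ring
    rw [e5]
    ring
  have hm11 := hmet 1 1
  have hm1i := hmet 1 Complex.I
  have hmi1 := hmet Complex.I 1
  have hmii := hmet Complex.I Complex.I
  simp at hm11 hm1i hmi1 hmii
  rw [gramDensity, Matrix.det_fin_two]
  simp only [Matrix.of_apply, Matrix.cons_val_zero, Matrix.cons_val_one]
  rw [hm11, hm1i, hmi1, hmii, mul_zero, sub_zero, Real.sqrt_mul_self]
  positivity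

theorem lineArea_apply {D : Set (complexLine c)} (hD : MeasurableSet D) :
    lineArea c D = ∫⁻ w in linePoint c ⁻¹' ((fun x : complexLine c => x.1.1) '' D),
      ENNReal.ofReal (4 * (herm c c).re / lineHeight c w ^ 2) := by
  have hemb : MeasurableEmbedding fun x : complexLine c => x.1.1 :=
    measurableEmbedding_coe_H2.comp
      (MeasurableEmbedding.subtype_coe (isClosed_complexLine c).measurableSet)
  have hD' := hemb.measurableSet_image.2 hD
  have hl := (continuous_linePoint c).measurable
  rw [lineArea, hemb.comap_apply, Measure.map_apply hl hD', withDensity_apply _ (hl hD')]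
  refine setLIntegral_congr_fun (hl hD') fun w hw => ?_
  obtain ⟨x, -, hx⟩ := hw
  rw [gramDensity_line hc]
  rw [← height_linePoint hc, ← hx]
  exact height_pos x.1

theorem continuous_proj : Continuous (proj c hc) := by
  have h := continuous_lift.comp (continuous_subtype_val (p := fun z : ℂ × ℂ =>
    Complex.normSq z.1 + Complex.normSq z.2 < 1))
  have h0 : ∀ i, Continuous fun z : H2 => lift z.1 i := fun i => (continuous_apply i).comp h
  have h1 : Continuous fun z : H2 => herm (lift z.1) c := by
    unfold herm
    exact (((h0 0).mul continuous_const).add ((h0 1).mul continuous_const)).sub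
      ((h0 2).mul continuous_const)
  have h2 : ∀ i, Continuous fun z : H2 =>
      (lift z.1 - (herm (lift z.1) c / herm c c) • c) i := fun i =>
    (h0 i).sub ((h1.div_const _).mul continuous_const)
  have h3 : ∀ z : H2, (lift z.1 - (herm (lift z.1) c / herm c c) • c) 2 ≠ 0 :=
    fun z => coord_ne_zero (proj_neg hc (lift_neg z))
  exact (((h2 0).div (h2 2) h3).prodMk ((h2 1).div (h2 2) h3)).subtype_mk _

theorem measurableSet_tubeOver (S : ℝ) {B : Set H2} (hB : MeasurableSet B) :
    MeasurableSet (tubeOver S c hc B) := by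
  have h := continuous_lift.comp (continuous_subtype_val (p := fun z : ℂ × ℂ =>
    Complex.normSq z.1 + Complex.normSq z.2 < 1))
  have h0 : ∀ i, Continuous fun z : H2 => lift z.1 i := fun i => (continuous_apply i).comp h
  have h1 : Continuous fun z : H2 => herm (lift z.1) c := by
    unfold herm
    exact (((h0 0).mul continuous_const).add ((h0 1).mul continuous_const)).sub
      ((h0 2).mul continuous_const)
  refine MeasurableSet.inter (IsOpen.measurableSet (isOpen_lt (h1.norm.pow 2) ?_))
    ((continuous_proj hc).measurable hB)
  simp only [herm_lift_re, neg_neg]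
  exact continuous_const.mul (continuous_height.comp continuous_subtype_val)

/-- Every point of a complex line occurs in its affine parametrization. -/
theorem exists_linePoint_eq {z : ℂ × ℂ} (hz : herm (lift z) c = 0) :
    ∃ w, linePoint c w = z := by
  have h0 := planarNormSq_ne_zero hc
  have h1 := planarNormSq_eq c
  have h2 : ((Complex.normSq (c 0) : ℂ) + (Complex.normSq (c 1) : ℂ)) = planarNormSq c := by
    simp [planarNormSq]
  have h3 : starRingEnd ℂ (c 2) = z.1 * starRingEnd ℂ (c 0) + z.2 * starRingEnd ℂ (c 1) := by
    simp [herm, lift] at hz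
    linear_combination -hz
  refine ⟨(z.2 * c 0 - z.1 * c 1) / planarNormSq c, ?_⟩
  ext
  · simp [linePoint, lineDir, h2, h3]
    field_simp
    rw [h1]
    ring
  · simp [linePoint, lineDir, h2, h3]
    field_simp
    rw [h1]
    ring

theorem herm_lineMatrix_re (w s : ℂ) :
    (herm ((lineMatrix c).mulVec (lift (w, s))) ((lineMatrix c).mulVec (lift (w, s)))).re
      = -(lineHeight c w - (herm c c).re * ‖s‖ ^ 2) := by
  rw [lineMatrix_mulVec, herm_add_self_re, herm_smul_smul_re, herm_lift_re, height_linePoint hc]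
  · ring
  · rw [herm_smul_right, herm_linePoint hc, mul_zero]

/-- The parameters, in the adapted coordinates, of a part of a tube. -/
def tubeParam (S : ℝ) (c : Fin 3 → ℂ) (B : Set H2) : Set (ℂ × ℂ) :=
  {p | linePoint c p.1 ∈ Subtype.val '' B ∧
    (herm c c).re * (1 + S) * ‖p.2‖ ^ 2 < S * lineHeight c p.1}

theorem lineHeight_pos_of_mem {B : Set H2} {w : ℂ} (hw : linePoint c w ∈ Subtype.val '' B) :
    0 < lineHeight c w := by
  obtain ⟨x, -, hx⟩ := hw
  rw [← height_linePoint hc, ← hx]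
  exact height_pos x

theorem tubeParam_neg {S : ℝ} (hS : 0 ≤ S) {B : Set H2} {p : ℂ × ℂ} (hp : p ∈ tubeParam S c B) :
    (herm ((lineMatrix c).mulVec (lift p)) ((lineMatrix c).mulVec (lift p))).re < 0 := by
  have h1 := herm_lineMatrix_re hc p.1 p.2
  have h2 := lineHeight_pos_of_mem hc hp.1
  have h3 := hp.2
  rw [Prod.mk.eta] at h1
  rw [h1]
  nlinarith [mul_nonneg hc.le (sq_nonneg ‖p.2‖)]

theorem herm_lineMatrix_polar (w s : ℂ) :
    herm ((lineMatrix c).mulVec (lift (w, s))) c = s * herm c c := by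
  rw [lineMatrix_mulVec, herm_add_left, herm_smul_left, herm_linePoint hc, zero_add]

theorem mem_tube_iff_lineMatrix {S : ℝ} {z : H2} {w s a : ℂ} (ha : a ≠ 0)
    (h : lift z.1 = a • (lineMatrix c).mulVec (lift (w, s))) :
    z ∈ tube S c ↔ (herm c c).re * (1 + S) * ‖s‖ ^ 2 < S * lineHeight c w := by
  simp only [tube, Set.mem_ofPred_eq]
  rw [h, herm_smul_left, herm_smul_smul_re, herm_lineMatrix_re hc, herm_lineMatrix_polar hc,
    norm_mul, mul_pow, norm_mul, mul_pow, herm_self c, Complex.norm_real,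
    Real.norm_of_nonneg hc.le, ← herm_self]
  have ha2 : 0 < ‖a‖ ^ 2 * (herm c c).re := by positivity
  rw [← mul_lt_mul_iff_right₀ (b := (herm c c).re * (1 + S) * ‖s‖ ^ 2)
    (c := S * lineHeight c w) ha2]
  constructor <;> intro h <;> linarith

/-- Each vector of the form `lift (linePoint c w) + s c` projects to the point of the line with
parameter `w`, so `B` constrains only `w`, and the tube condition becomes a disc condition on `s`.
Conversely, normalizing the last coordinate of the projection of a lift to `1` recovers `w` and `s`.
-/
theorem coe_image_tubeOver {S : ℝ} (hS : 0 ≤ S) {B : Set H2} (hB : B ⊆ complexLine c) :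
    Subtype.val '' tubeOver S c hc B = chartMap (lineMatrix c) '' tubeParam S c B := by
  have hc0 := herm_self_ne_zero hc
  ext x
  constructor
  · rintro ⟨z, ⟨hzt, hzB⟩, rfl⟩
    set t := herm (lift z.1) c / herm c c with ht
    have hY := proj_neg hc (lift_neg z)
    set Y := lift z.1 - t • c with hYdef
    have hY2 : Y 2 ≠ 0 := coord_ne_zero hY
    obtain ⟨w, hw⟩ := exists_linePoint_eq hc (show herm (lift (proj c hc z).1) c = 0 from hB hzB)
    have hL : lift (linePoint c w) = (Y 2)⁻¹ • Y := by
      rw [hw]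
      exact lift_dehom hY2
    have hX : (lineMatrix c).mulVec (lift (w, t / Y 2)) = (Y 2)⁻¹ • lift z.1 := by
      have hz : lift z.1 = Y + t • c := by rw [hYdef]; abel
      rw [lineMatrix_mulVec, hz, hL, smul_add, smul_smul, div_eq_inv_mul]
    refine ⟨(w, t / Y 2), ⟨⟨_, hzB, hw.symm⟩, ?_⟩, ?_⟩
    · refine (mem_tube_iff_lineMatrix hc hY2 ?_).1 hzt
      rw [hX, smul_smul, mul_inv_cancel₀ hY2, one_smul]
    · rw [chartMap, hX, dehom_smul (inv_ne_zero hY2), dehom_lift]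
  · rintro ⟨⟨w, s⟩, hp, rfl⟩
    have hneg := tubeParam_neg hc hS hp
    set X := (lineMatrix c).mulVec (lift (w, s)) with hX
    have hX2 : X 2 ≠ 0 := coord_ne_zero hneg
    have hlift : lift (mkPt X hneg).1 = (X 2)⁻¹ • X := lift_mkPt X hneg
    refine ⟨mkPt X hneg, ⟨?_, ?_⟩, rfl⟩
    · exact (mem_tube_iff_lineMatrix hc (inv_ne_zero hX2) hlift).2 hp.2
    · obtain ⟨b, hb, hbw⟩ := hp.1
      convert hb
      apply Subtype.ext
      rw [hbw]
      change dehom (lift (mkPt X hneg).1 - (herm (lift (mkPt X hneg).1) c / herm c c) • c) = _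
      have h1 : lift (mkPt X hneg).1 - (herm (lift (mkPt X hneg).1) c / herm c c) • c
          = (X 2)⁻¹ • lift (linePoint c w) := by
        rw [hlift, herm_smul_left, hX, herm_lineMatrix_polar hc, ← hX, ← mul_assoc,
          mul_div_cancel_right₀ _ hc0, mul_smul, ← smul_sub, hX, lineMatrix_mulVec,
          add_sub_cancel_right]
      rw [h1, dehom_smul (inv_ne_zero hX2), dehom_lift]

omit hc in
theorem measurableSet_tubeParam (S : ℝ) {B : Set H2} (hB : MeasurableSet B) :
    MeasurableSet (tubeParam S c B) := by
  refine MeasurableSet.inter ?_ ?_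
  · exact ((continuous_linePoint c).comp continuous_fst).measurable
      (measurableEmbedding_coe_H2.measurableSet_image.2 hB)
  · refine (isOpen_lt (f := fun p : ℂ × ℂ => (herm c c).re * (1 + S) * ‖p.2‖ ^ 2)
      (g := fun p : ℂ × ℂ => S * lineHeight c p.1) (by fun_prop) ?_).measurableSet
    unfold lineHeight
    fun_prop

/-- The volume of the part of a tube over a subset of its axis. -/
theorem hypVolume_tubeOver {S : ℝ} (hS : 0 ≤ S) {D : Set (complexLine c)} (hD : MeasurableSet D) :
    hypVolume (tubeOver S c hc (Subtype.val '' D))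
      = ENNReal.ofReal (2 * Real.pi * ((1 + S) ^ 2 - 1)) * lineArea c D := by
  have hB : MeasurableSet (Subtype.val '' D : Set H2) :=
    (MeasurableEmbedding.subtype_coe (isClosed_complexLine c).measurableSet).measurableSet_image.2 hD
  have hBc : (Subtype.val '' D : Set H2) ⊆ complexLine c := by
    rintro _ ⟨x, -, rfl⟩
    exact x.2
  have hdet : (lineMatrix c).det ≠ 0 := by
    rw [det_lineMatrix hc]
    exact neg_ne_zero.2 (herm_self_ne_zero hc)
  have hEm : MeasurableSet (tubeParam S c (Subtype.val '' D)) := measurableSet_tubeParam S hB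
  rw [hypVolume_image hdet hEm (fun z hz => tubeParam_neg hc hS hz)
    (measurableSet_tubeOver hc S hB) (coe_image_tubeOver hc hS hBc)]
  set W := linePoint c ⁻¹' ((fun x : complexLine c => x.1.1) '' D) with hW
  have hWB : ∀ w, linePoint c w ∈ Subtype.val '' (Subtype.val '' D : Set H2) ↔ w ∈ W := by
    intro w
    rw [Set.image_image]
    rfl
  have hWm : MeasurableSet W := by
    have : W = linePoint c ⁻¹' (Subtype.val '' (Subtype.val '' D : Set H2)) := by
      ext w
      exact (hWB w).symm
    rw [this]
    exact (continuous_linePoint c).measurable (measurableEmbedding_coe_H2.measurableSet_image.2 hB)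
  let f : ℂ × ℂ → ℝ≥0∞ := fun p => ENNReal.ofReal (16 * (herm c c).re ^ 2 /
    (lineHeight c p.1 - (herm c c).re * ‖p.2‖ ^ 2) ^ 3)
  have hf : Measurable f := by
    unfold f lineHeight
    fun_prop
  have h1 : ∀ z ∈ tubeParam S c (Subtype.val '' D), ENNReal.ofReal
      (16 * Complex.normSq (lineMatrix c).det / (-(herm ((lineMatrix c).mulVec (lift z))
        ((lineMatrix c).mulVec (lift z))).re) ^ 3) = f z := by
    rintro ⟨w, s⟩ -
    rw [det_lineMatrix hc, herm_lineMatrix_re hc, neg_neg, Complex.normSq_neg, herm_self c,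
      Complex.normSq_ofReal, ← sq]
    simp [f]
  -- By Tonelli, it remains to integrate over the fibre discs: each contributes a constant multiple
  -- of the area density of the line.
  have h2 : ∀ w, ∫⁻ s, (tubeParam S c (Subtype.val '' D)).indicator f (w, s)
      = W.indicator (fun w => ENNReal.ofReal (2 * Real.pi * ((1 + S) ^ 2 - 1)) *
        ENNReal.ofReal (4 * (herm c c).re / lineHeight c w ^ 2)) w := by
    intro w
    by_cases hw : w ∈ W
    · rw [Set.indicator_of_mem hw]
      have hP := lineHeight_pos_of_mem hc ((hWB w).2 hw)
      rw [← lintegral_disc hP hc hS, ← lintegral_indicator]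
      · congr 1 with s
        have hmem : (w, s) ∈ tubeParam S c (Subtype.val '' D) ↔
            s ∈ {s : ℂ | (herm c c).re * (1 + S) * ‖s‖ ^ 2 < S * lineHeight c w} :=
          ⟨fun h => h.2, fun h => ⟨(hWB w).2 hw, h⟩⟩
        by_cases hs : (w, s) ∈ tubeParam S c (Subtype.val '' D)
        · rw [Set.indicator_of_mem hs, Set.indicator_of_mem (hmem.1 hs)]
        · rw [Set.indicator_of_notMem hs, Set.indicator_of_notMem (fun h => hs (hmem.2 h))]
      · exact (isOpen_lt (by fun_prop) continuous_const).measurableSet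
    · rw [Set.indicator_of_notMem hw]
      have : ∀ s, (tubeParam S c (Subtype.val '' D)).indicator f (w, s) = 0 := fun s =>
        Set.indicator_of_notMem (fun h => hw ((hWB w).1 h.1)) f
      simp [this]
  rw [setLIntegral_congr_fun hEm h1, ← lintegral_indicator hEm, Measure.volume_eq_prod,
    lintegral_prod _ (hf.indicator hEm).aemeasurable]
  simp only [h2]
  rw [lintegral_indicator hWm, lintegral_const_mul _ (by unfold lineHeight; fun_prop),
    lineArea_apply hc hD]

end Line

/-! ### Proper discontinuity -/

theorem isClosed_scalars : IsClosed (scalars : Set U21) := by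
  have h : (scalars : Set U21) = ⋂ x : Fin 3 → ℂ, ⋂ i : Fin 3,
      {g : U21 | g.val.val.mulVec x i = g.val.val 0 0 * x i} := by
    ext g
    simp only [Set.mem_iInter, Set.mem_ofPred_eq]
    constructor
    · rintro ⟨a, ha⟩ x i
      have h1 := congrFun (ha (Pi.single 0 1)) 0
      simp at h1
      rw [ha, h1]
      rfl
    · intro h
      exact ⟨g.val.val 0 0, fun x => funext fun i => h x i⟩
  rw [h]
  refine isClosed_iInter fun x => isClosed_iInter fun i => isClosed_eq ?_ ?_
  · exact (continuous_apply i).comp (continuous_coe_U21.matrix_mulVec continuous_const)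
  · exact (continuous_coe_U21.matrix_elem 0 0).mul continuous_const

instance : T2Space PU21 := by
  have := isClosed_scalars
  infer_instance

/-- Because the inverse is `J Mᴴ J`, the topology is induced from that of the matrices. This makes a
discrete `Γ` countable. -/
instance : SecondCountableTopology U21 := by
  have h1 : Topology.IsInducing fun g : U21 => g.val.val := by
    have h2 : Topology.IsInducing fun M : {M : Matrix (Fin 3) (Fin 3) ℂ // Mᴴ * J * M = J} =>
      M.1 := Topology.IsInducing.subtypeVal
    have h3 : ∀ g : U21, ofMatrix g.val.val (preserves_iff.1 g.2) = g := fun g =>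
      U21_ext fun x => rfl
    refine ⟨le_antisymm continuous_coe_U21.le_induced ?_⟩
    intro s hs
    have hs' : IsOpen s := hs
    have := hs'.preimage continuous_ofMatrix
    obtain ⟨t, ht, hts⟩ := h2.isOpen_iff.1 this
    refine ⟨t, ht, ?_⟩
    ext g
    have := Set.ext_iff.1 hts ⟨g.val.val, preserves_iff.1 g.2⟩
    rw [Set.mem_preimage, Set.mem_preimage, h3] at this
    exact this
  have : SecondCountableTopology (Matrix (Fin 3) (Fin 3) ℂ) :=
    inferInstanceAs (SecondCountableTopology (Fin 3 → Fin 3 → ℂ))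
  exact h1.secondCountableTopology

theorem countable_of_discrete (Γ : Subgroup PU21) [DiscreteTopology Γ] : Countable Γ :=
  TopologicalSpace.separableSpace_iff_countable.1 inferInstance

/-- Adding `2|⟨y,W⟩|²/height W` to `⟨y,y⟩` reverses the sign of the form along the lift of `W` and
makes it positive definite. The inequality is a quantitative form of this, uniform as long as the
height is bounded below. -/
theorem planar_bound (y : Fin 3 → ℂ) (W : H2) :
    height W.1 * (‖y 0‖ ^ 2 + ‖y 1‖ ^ 2) ≤
      2 * ((herm y y).re + 2 * ‖herm y (lift W.1)‖ ^ 2 / height W.1) := by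
  have hb := height_pos W
  have hb1 : height W.1 ≤ 1 := by
    unfold height
    linarith [Complex.normSq_nonneg W.1.1, Complex.normSq_nonneg W.1.2]
  rw [herm_self_re_norm]
  set b := height W.1 with hbdef
  have hp := normSq_add_le (y 0) (y 1) W.1.1 W.1.2
  have hW : ‖W.1.1‖ ^ 2 + ‖W.1.2‖ ^ 2 = 1 - b := by
    rw [hbdef, height, Complex.normSq_eq_norm_sq, Complex.normSq_eq_norm_sq]; ring
  rw [hW] at hp
  set p := y 0 * starRingEnd ℂ W.1.1 + y 1 * starRingEnd ℂ W.1.2 with hpdef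
  have hh : herm y (lift W.1) = p - y 2 := by simp [herm, lift, hpdef]
  rw [hh]
  have ht : ‖y 2‖ ≤ ‖p‖ + ‖p - y 2‖ := by
    have := norm_sub_le p (p - y 2)
    simpa using this
  set u := ‖y 0‖ ^ 2 + ‖y 1‖ ^ 2 with hu
  set δ := ‖p - y 2‖
  have hδ : 0 ≤ δ := norm_nonneg _
  have h1 : ‖y 2‖ ^ 2 ≤ (‖p‖ + δ) ^ 2 := pow_le_pow_left₀ (norm_nonneg _) ht 2
  -- A weighted form of `(p + δ)² ≤ (1 + t)p² + (1 + 1/t)δ²` with `t = b/(2 - b)`. The weight is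
  -- chosen so that, together with `|p|² ≤ (1 - b)u`, a positive multiple of `u` survives.
  have h2 : b * (2 - b) * ‖y 2‖ ^ 2 ≤ 2 * b * ‖p‖ ^ 2 + 2 * (2 - b) * δ ^ 2 := by
    have h3 : b * (2 - b) * ‖y 2‖ ^ 2 ≤ b * (2 - b) * (‖p‖ + δ) ^ 2 :=
      mul_le_mul_of_nonneg_left h1 (by nlinarith)
    nlinarith [sq_nonneg (b * ‖p‖ - (2 - b) * δ)]
  have hu0 : 0 ≤ u := by positivity
  have h4 : b * b * u ≤ (2 - b) * (b * u - b * ‖y 2‖ ^ 2 + 2 * δ ^ 2) := by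
    nlinarith
  have h5 : 0 ≤ b * u - b * ‖y 2‖ ^ 2 + 2 * δ ^ 2 := by
    have : 0 ≤ b * b * u := by positivity
    by_contra hneg
    nlinarith
  have h6 : b * b * u ≤ 2 * (b * u - b * ‖y 2‖ ^ 2 + 2 * δ ^ 2) := by nlinarith
  have h7 : 2 * (u - ‖y 2‖ ^ 2 + 2 * δ ^ 2 / b)
      = 2 * (b * u - b * ‖y 2‖ ^ 2 + 2 * δ ^ 2) / b := by
    field_simp
  rw [h7, le_div_iff₀ hb]
  linarith

/-- An isometry carrying a point of a compact ball to the ball has bounded matrix entries. -/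
theorem norm_entry_sq_le {ε : ℝ} (hε : 0 < ε) (g : U21) (z : H2) (hz : ε ≤ height z.1)
    (hgz : ε ≤ height (g • z).1) (i j : Fin 3) :
    ‖g.val.val i j‖ ^ 2 ≤ 1 + 2 / ε * (1 + 2 / ε) := by
  set x : Fin 3 → ℂ := Pi.single j 1 with hx
  set y := g.val.val.mulVec x with hy
  have hyi : ∀ i, y i = g.val.val i j := fun i => by simp [hy, hx]
  have hxx : |(herm x x).re| ≤ 1 := by
    fin_cases j <;> simp [hx, herm]
  have hyy : (herm y y).re = (herm x x).re := by rw [hy, g.2]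
  have hxZ : ‖herm x (lift z.1)‖ ^ 2 ≤ 1 := by
    have hz' := z.2
    rw [Complex.normSq_eq_norm_sq, Complex.normSq_eq_norm_sq] at hz'
    fin_cases j <;> simp only [hx, herm, lift] <;> simp
    · nlinarith [norm_nonneg z.1.1, sq_nonneg ‖z.1.2‖]
    · nlinarith [norm_nonneg z.1.2, sq_nonneg ‖z.1.1‖]
  have hzpos := height_pos z
  have hgpos := height_pos (g • z)
  -- This quotient does not depend on the lift and is invariant under `g`, so it is computed at `z`,
  -- where `x` is a basis vector.
  have hW : ‖herm y (lift (g • z).1)‖ ^ 2 / height (g • z).1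
      = ‖herm x (lift z.1)‖ ^ 2 / height z.1 := by
    have h2 := coord_ne_zero (herm_image_neg g z)
    have h3 : height (g • z).1 = ‖(g.val.val.mulVec (lift z.1) 2)⁻¹‖ ^ 2 * height z.1 := by
      have := herm_lift_re (g • z).1
      rw [lift_smul, herm_smul_smul_re, g.2, herm_lift_re] at this
      linarith
    have h4 : 0 < ‖(g.val.val.mulVec (lift z.1) 2)⁻¹‖ ^ 2 := by
      have := norm_pos_iff.2 (inv_ne_zero h2)
      positivity
    rw [h3, lift_smul, herm_smul_right, hy, g.2, norm_mul, Complex.norm_conj, mul_pow,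
      mul_div_mul_left _ _ h4.ne']
  have hb := planar_bound y (g • z)
  rw [mul_div_assoc, hW, hyy] at hb
  have h5 : ‖herm x (lift z.1)‖ ^ 2 / height z.1 ≤ 1 / ε :=
    div_le_div₀ zero_le_one hxZ hε hz
  have h6 : (herm x x).re ≤ 1 := (le_abs_self _).trans hxx
  have hu0 : 0 ≤ ‖y 0‖ ^ 2 + ‖y 1‖ ^ 2 := by positivity
  have h7 : ‖y 0‖ ^ 2 + ‖y 1‖ ^ 2 ≤ 2 / ε * (1 + 2 / ε) := by
    have h8 : ε * (‖y 0‖ ^ 2 + ‖y 1‖ ^ 2) ≤ 2 * (1 + 2 * (1 / ε)) := by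
      nlinarith [mul_le_mul_of_nonneg_right hgz hu0]
    rw [div_mul_eq_mul_div, le_div_iff₀ hε]
    have h9 : 2 * (1 / ε) = 2 / ε := by ring
    rw [h9] at h8
    linarith
  have h8 : ‖y 2‖ ^ 2 ≤ 1 + (‖y 0‖ ^ 2 + ‖y 1‖ ^ 2) := by
    have h9 := herm_self_re_norm y
    rw [hyy] at h9
    have := neg_abs_le (herm x x).re
    linarith
  rw [← hyi]
  have h10 := sq_nonneg ‖y 0‖
  have h11 := sq_nonneg ‖y 1‖
  fin_cases i
  · change ‖y 0‖ ^ 2 ≤ _; linarith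
  · change ‖y 1‖ ^ 2 ≤ _; linarith
  · change ‖y 2‖ ^ 2 ≤ _; linarith

theorem isCompact_bounded_U21 (R : ℝ) :
    IsCompact ((fun g : U21 => (QuotientGroup.mk g : PU21)) ''
      {g : U21 | ∀ i j, ‖g.val.val i j‖ ≤ R}) := by
  let C : Set (Matrix (Fin 3) (Fin 3) ℂ) :=
    (Set.univ.pi fun _ => Set.univ.pi fun _ => Metric.closedBall 0 R : Set (Fin 3 → Fin 3 → ℂ))
  have hC : IsCompact C :=
    isCompact_univ_pi fun _ => isCompact_univ_pi fun _ => isCompact_closedBall _ _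
  have hmemC : ∀ M, M ∈ C ↔ ∀ i j, ‖M i j‖ ≤ R :=
    (by simp [Set.mem_pi] : ∀ M : Fin 3 → Fin 3 → ℂ, M ∈ (Set.univ.pi fun _ =>
      Set.univ.pi fun _ => Metric.closedBall 0 R : Set (Fin 3 → Fin 3 → ℂ)) ↔
      ∀ i j, ‖M i j‖ ≤ R)
  have hclosed : IsClosed {M : Matrix (Fin 3) (Fin 3) ℂ | Mᴴ * J * M = J} :=
    isClosed_eq (by fun_prop) continuous_const
  have hC' := hclosed.isClosedEmbedding_subtypeVal.isCompact_preimage hC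
  have himage := hC'.image ((continuous_quotient_mk' (s := QuotientGroup.leftRel scalars)).comp
    continuous_ofMatrix)
  refine (congrArg IsCompact (Set.ext fun γ => ?_)).mpr himage
  constructor
  · rintro ⟨g, hg, rfl⟩
    exact ⟨⟨g.val.val, preserves_iff.1 g.2⟩, (hmemC _).2 hg,
      congrArg QuotientGroup.mk (U21_ext fun x => rfl)⟩
  · rintro ⟨M, hM, rfl⟩
    exact ⟨ofMatrix M.1 M.2, (hmemC _).1 hM, rfl⟩

/-- A discrete group contains finitely many elements moving some point of a compact ball into the
ball. -/
theorem finite_returning (Γ : Subgroup PU21) [DiscreteTopology Γ] {ε : ℝ} (hε : 0 < ε) :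
    {γ : PU21 | γ ∈ Γ ∧ ∃ z : H2, ε ≤ height z.1 ∧ ε ≤ height (γ • z).1}.Finite := by
  set R := Real.sqrt (1 + 2 / ε * (1 + 2 / ε)) with hR
  have hclosed : IsClosed (Γ : Set PU21) := Subgroup.isClosed_of_discrete
  have hfin : ((Γ : Set PU21) ∩ ((fun g : U21 => (QuotientGroup.mk g : PU21)) ''
      {g : U21 | ∀ i j, ‖g.val.val i j‖ ≤ R})).Finite := by
    refine ((isCompact_bounded_U21 R).inter_left hclosed).finite ?_
    have : IsDiscrete (Γ : Set PU21) := ⟨inferInstanceAs (DiscreteTopology Γ)⟩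
    exact this.mono Set.inter_subset_left
  refine hfin.subset ?_
  rintro γ ⟨hγ, z, hz, hgz⟩
  obtain ⟨g, rfl⟩ := QuotientGroup.mk_surjective γ
  exact ⟨hγ, g, fun i j => Real.le_sqrt_of_sq_le (norm_entry_sq_le hε g z hz hgz i j), rfl⟩

/-- A point not fixed by nontrivial transformations has a neighbourhood disjoint from all its
translates. -/
theorem eventually_disjoint_smul (Γ : Subgroup PU21) [DiscreteTopology Γ] {z : H2}
    (hz : ∀ σ : permGroup Γ, σ ≠ 1 → σ • z ≠ z) :
    ∀ᶠ U in (𝓝 z).smallSets, ∀ σ : permGroup Γ, σ ≠ 1 → Disjoint (σ • U) U := by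
  set ε := height z.1 / 2 with hε
  have hε0 : 0 < ε := half_pos (height_pos z)
  have hV : {w : H2 | ε < height w.1} ∈ 𝓝 z :=
    (isOpen_lt continuous_const (continuous_height.comp continuous_subtype_val)).mem_nhds
      (half_lt_self (height_pos z))
  -- Only these transformations can return a neighbourhood in `ε < height` to itself. Each
  -- nontrivial one moves `z` and is handled by separating `z` from its image.
  have hfin : {σ : permGroup Γ | ∃ w : H2, ε ≤ height w.1 ∧ ε ≤ height (σ • w).1}.Finite := by
    choose f hf using permGroup_exists Γ
    have hinj : Function.Injective f := by
      intro σ τ h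
      apply Subtype.ext
      ext1 w
      change σ • w = τ • w
      rw [(hf σ).2, (hf τ).2, h]
    refine Set.Finite.of_finite_image ((finite_returning Γ hε0).subset ?_) hinj.injOn
    rintro _ ⟨σ, ⟨w, h1, h2⟩, rfl⟩
    exact ⟨(hf σ).1, w, h1, by rwa [← (hf σ).2]⟩
  have hall : ∀ᶠ U in (𝓝 z).smallSets, ∀ σ ∈ {σ : permGroup Γ | ∃ w : H2, ε ≤ height w.1 ∧
      ε ≤ height (σ • w).1}, σ ≠ 1 → Disjoint (σ • U) U := by
    rw [hfin.eventually_all]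
    intro σ _
    by_cases hσ : σ = 1
    · exact Eventually.of_forall fun U h => absurd hσ h
    obtain ⟨A, B, hA, hB, hzA, hzB, hAB⟩ := t2_separation (hz σ hσ)
    have hA' : (fun w : H2 => σ • w) ⁻¹' A ∈ 𝓝 z :=
      (continuous_const_smul σ).continuousAt.preimage_mem_nhds (hA.mem_nhds hzA)
    rw [eventually_smallSets]
    refine ⟨_, inter_mem hA' (hB.mem_nhds hzB), fun U hU _ => ?_⟩
    refine hAB.mono ?_ fun w hw => (hU hw).2
    rintro _ ⟨w, hw, rfl⟩
    exact (hU hw).1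
  filter_upwards [hall, eventually_smallSets_subset.2 hV] with U hU hUV σ hσ
  by_contra hnd
  obtain ⟨x, ⟨w, hw, rfl⟩, hx⟩ := Set.not_disjoint_iff.1 hnd
  exact hnd (hU σ ⟨w, (hUV hw).le, (hUV hx).le⟩ hσ)

/-! ### Fixed points -/

theorem volume_zeros_affine (r : Fin 3 → ℂ) (hr : r ≠ 0) :
    (volume : Measure (ℂ × ℂ)) {z | r 0 * z.1 + r 1 * z.2 + r 2 = 0} = 0 := by
  let s : AffineSubspace ℝ (ℂ × ℂ) :=
    { carrier := {z | r 0 * z.1 + r 1 * z.2 + r 2 = 0}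
      smul_vsub_vadd_mem' := by
        intro t p q x hp hq hx
        simp only [Set.mem_ofPred_eq] at hp hq hx ⊢
        simp only [vsub_eq_sub, vadd_eq_add, Prod.fst_add, Prod.snd_add, Prod.smul_fst,
          Prod.smul_snd, Prod.fst_sub, Prod.snd_sub, Complex.real_smul]
        linear_combination (t : ℂ) * (hp - hq) + hx }
  have hs : s ≠ ⊤ := by
    intro h
    have hall : ∀ z : ℂ × ℂ, r 0 * z.1 + r 1 * z.2 + r 2 = 0 := by
      intro z
      have : z ∈ s := by rw [h]; trivial
      exact this
    have h2 := hall (0, 0)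
    have h0 := hall (1, 0)
    have h1 := hall (0, 1)
    simp only [mul_zero, mul_one, add_zero, zero_add] at h0 h1 h2
    rw [h2, add_zero] at h0 h1
    apply hr
    ext i
    fin_cases i
    · exact h0
    · exact h1
    · exact h2
  exact Measure.addHaar_affineSubspace volume s hs

theorem volume_eigenpoints (M : Matrix (Fin 3) (Fin 3) ℂ) (hM : M ≠ 0) :
    (volume : Measure (ℂ × ℂ)) {z | M.mulVec (lift z) = 0} = 0 := by
  obtain ⟨i, hi⟩ : ∃ i, M i ≠ 0 := by
    by_contra! h
    exact hM (funext h)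
  refine measure_mono_null ?_ (volume_zeros_affine (M i) hi)
  intro z hz
  have := congrFun hz i
  rwa [mulVec_lift] at this

/-- The lift of a fixed point is an eigenvector. There are finitely many eigenvalues, and each
eigenspace is proper because `g` is not scalar, so it meets the chart in a null set. -/
theorem hypVolume_fixed (g : U21) (hg : ∃ z : H2, g • z ≠ z) :
    hypVolume {z : H2 | g • z = z} = 0 := by
  set f := Matrix.mulVecLin g.val.val with hf
  have hns : ∀ μ : ℂ, g.val.val - μ • (1 : Matrix (Fin 3) (Fin 3) ℂ) ≠ 0 := by
    intro μ h
    obtain ⟨z, hz⟩ := hg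
    apply hz
    have hsc : g ∈ scalars := by
      refine ⟨μ, fun x => ?_⟩
      rw [sub_eq_zero.1 h, Matrix.smul_mulVec, Matrix.one_mulVec]
    have h1 : (QuotientGroup.mk g : PU21) = 1 := (QuotientGroup.eq_one_iff g).2 hsc
    rw [← mk_smul, h1, one_smul]
  have hnull : (volume : Measure (ℂ × ℂ)) (⋃ μ ∈ {μ | Module.End.HasEigenvalue f μ},
      {z | (g.val.val - μ • (1 : Matrix (Fin 3) (Fin 3) ℂ)).mulVec (lift z) = 0}) = 0 :=
    (measure_biUnion_null_iff (Module.End.finite_hasEigenvalue f).countable).2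
      fun μ _ => volume_eigenpoints _ (hns μ)
  rw [hypVolume, measurableEmbedding_coe_H2.comap_apply]
  refine withDensity_absolutelyContinuous _ _ (measure_mono_null ?_ hnull)
  rintro _ ⟨z, hz, rfl⟩
  have h1 := congrArg (fun w : H2 => lift w.1) (show g • z = z from hz)
  simp only [lift_smul] at h1
  have h2 := coord_ne_zero (herm_image_neg g z)
  set μ := g.val.val.mulVec (lift z.1) 2
  have h3 : g.val.val.mulVec (lift z.1) = μ • lift z.1 := by
    rw [← h1, smul_smul, mul_inv_cancel₀ h2, one_smul, h1]
  have h4 : lift z.1 ≠ 0 := by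
    intro h
    have := congrFun h 2
    simp [lift] at this
  refine Set.mem_biUnion (x := μ) ?_ ?_
  · exact Module.End.hasEigenvalue_of_hasEigenvector
      ⟨Module.End.mem_eigenspace_iff.2 h3, h4⟩
  · change _ = _
    rw [Matrix.sub_mulVec, Matrix.smul_mulVec, Matrix.one_mulVec, h3, sub_self]

/-- A discrete group has a fundamental domain in the complex hyperbolic plane. -/
theorem exists_isFundamentalDomain (Γ : Subgroup PU21) [DiscreteTopology Γ] :
    ∃ F : Set H2, IsFundamentalDomain (permGroup Γ) F hypVolume := by
  have hΓ := countable_of_discrete Γ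
  have hG : Countable (permGroup Γ) :=
    (MonoidHom.rangeRestrict_surjective (MulAction.toPermHom Γ H2)).countable
  -- The empty set is included so that the family is nonempty and can be enumerated.
  let b : Set (Set H2) := {U | (U ∈ TopologicalSpace.countableBasis H2 ∨ U = ∅) ∧
    ∀ σ : permGroup Γ, σ ≠ 1 → Disjoint (σ • U) U}
  have hb : b.Countable := by
    refine ((TopologicalSpace.countable_countableBasis H2).insert ∅).mono ?_
    rintro U ⟨h | h, -⟩
    · exact Or.inr h
    · exact Or.inl h
  obtain ⟨U, hU⟩ := hb.exists_eq_range ⟨∅, Or.inr rfl, fun σ _ => by simp⟩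
  have hUb : ∀ n, U n ∈ b := fun n => by rw [hU]; exact ⟨n, rfl⟩
  have hUo : ∀ n, MeasurableSet (U n) := by
    intro n
    rcases (hUb n).1 with h | h
    · exact (TopologicalSpace.isOpen_of_mem_countableBasis h).measurableSet
    · rw [h]; exact MeasurableSet.empty
  -- Each set is kept only where no translate of an earlier one has already represented the orbit.
  let F : Set H2 := ⋃ n, U n \ ⋃ m, ⋃ (_ : m < n), ⋃ σ : permGroup Γ, σ • U m
  have hF : MeasurableSet F := MeasurableSet.iUnion fun n => (hUo n).diff
    (MeasurableSet.iUnion fun m => MeasurableSet.iUnion fun _ =>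
      MeasurableSet.iUnion fun σ => (hUo m).const_smul σ)
  have hmemF : ∀ x, x ∈ F ↔ ∃ n, x ∈ U n ∧ ∀ m < n, ∀ σ : permGroup Γ, x ∉ σ • U m := by
    intro x
    simp only [F, Set.mem_iUnion, Set.mem_sdiff, not_exists]
  refine ⟨F, IsFundamentalDomain.mk'' hF.nullMeasurableSet ?_ ?_
    fun σ => (measurePreserving_smul σ hypVolume).quasiMeasurePreserving⟩
  · have hfree : ∀ᵐ z ∂hypVolume, ∀ σ : permGroup Γ, σ ≠ 1 → σ • z ≠ z := by
      rw [ae_all_iff]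
      intro σ
      by_cases hσ : σ = 1
      · exact Eventually.of_forall fun z h => absurd hσ h
      obtain ⟨γ, -, hγ⟩ := permGroup_exists Γ σ
      obtain ⟨g, rfl⟩ := QuotientGroup.mk_surjective γ
      have hex : ∃ z : H2, g • z ≠ z := by
        by_contra! h
        apply hσ
        apply Subtype.ext
        ext1 w
        change σ • w = w
        rw [hγ, mk_smul, h]
      rw [ae_iff]
      refine measure_mono_null ?_ (hypVolume_fixed g hex)
      intro z hz
      simp only [Set.mem_ofPred_eq, not_forall, not_not] at hz
      obtain ⟨-, hz⟩ := hz
      rwa [hγ, mk_smul] at hz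
    filter_upwards [hfree] with z hz
    -- Almost every point has trivial stabilizer, hence lies in a basic open set disjoint from its
    -- translates. The least index reached by the orbit then provides a representative in `F`.
    have hexn : ∃ n, ∃ σ : permGroup Γ, σ • z ∈ U n := by
      obtain ⟨V, hV, hV'⟩ := eventually_smallSets.1 (eventually_disjoint_smul Γ hz)
      obtain ⟨W, hW, hzW, hWV⟩ :=
        (TopologicalSpace.isBasis_countableBasis H2).mem_nhds_iff.1 hV
      have hWb : W ∈ b := ⟨Or.inl hW, hV' W hWV⟩
      rw [hU] at hWb
      obtain ⟨n, rfl⟩ := hWb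
      exact ⟨n, 1, by rwa [one_smul]⟩
    classical
    obtain ⟨σ, hσ⟩ := Nat.find_spec hexn
    refine ⟨σ, (hmemF _).2 ⟨_, hσ, fun m hm τ hτ => Nat.find_min hexn hm ⟨τ⁻¹ * σ, ?_⟩⟩⟩
    rw [mul_smul]
    exact Set.mem_smul_set_iff_inv_smul_mem.1 hτ
  · intro σ hσ
    refine Disjoint.aedisjoint (Set.disjoint_left.2 ?_)
    rintro _ ⟨x, hx, rfl⟩ hy
    obtain ⟨n, hn, hn'⟩ := (hmemF _).1 hx
    obtain ⟨m, hm, hm'⟩ := (hmemF _).1 hy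
    rcases lt_trichotomy m n with h | h | h
    · refine hn' m h σ⁻¹ ?_
      rw [Set.mem_smul_set_iff_inv_smul_mem, inv_inv]
      exact hm
    · subst h
      exact Set.disjoint_left.1 ((hUb m).2 σ hσ) (Set.smul_mem_smul_set hn) hm
    · exact hm' n h σ (Set.smul_mem_smul_set hn)

/-! ### The volume bound -/

/-- The order `7` is the first with `π/n < π/6`, that is, with `2 sin(π/n) < 1`. -/
theorem sin_pi_div_bounds {n : ℕ} (hn : 7 ≤ n) :
    0 < Real.sin (Real.pi / n) ∧ Real.sin (Real.pi / n) < 1 / 2 := by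
  have hn' : (7 : ℝ) ≤ n := by exact_mod_cast hn
  have hpi := Real.pi_pos
  have h1 : Real.pi / n ≤ Real.pi / 7 := div_le_div_of_nonneg_left hpi.le (by norm_num) hn'
  have h0 : 0 < Real.pi / n := by positivity
  refine ⟨Real.sin_pos_of_pos_of_lt_pi h0 (by linarith), ?_⟩
  rw [← Real.sin_pi_div_six]
  exact Real.sin_lt_sin_of_lt_of_le_pi_div_two (by linarith) (by linarith) (by linarith)

/-- The derivative is nonpositive because `sin x - x cos x ≤ sin x (1 - cos x) ≤ sin³ x ≤ 2 sin² x`,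
by `sin x < x` and `1 - cos x ≤ sin² x`. -/
theorem antitoneOn_div_sin_sub : AntitoneOn (fun x : ℝ => x / Real.sin x - 2 * x)
    (Set.Ioo 0 (Real.pi / 2)) := by
  have hsin : ∀ x ∈ Set.Ioo 0 (Real.pi / 2), 0 < Real.sin x := fun x hx =>
    Real.sin_pos_of_pos_of_lt_pi hx.1 (by linarith [hx.2, Real.pi_pos])
  have hderiv : ∀ x ∈ Set.Ioo 0 (Real.pi / 2), HasDerivAt (fun x : ℝ => x / Real.sin x - 2 * x)
      ((1 * Real.sin x - x * Real.cos x) / Real.sin x ^ 2 - 2 * 1) x := fun x hx =>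
    ((hasDerivAt_id x).div (Real.hasDerivAt_sin x) (hsin x hx).ne').sub
      ((hasDerivAt_id x).const_mul 2)
  refine antitoneOn_of_deriv_nonpos (convex_Ioo _ _)
    (fun x hx => (hderiv x hx).continuousAt.continuousWithinAt) ?_ ?_
  · rw [interior_Ioo]
    exact fun x hx => (hderiv x hx).differentiableAt.differentiableWithinAt
  · rw [interior_Ioo]
    intro x hx
    rw [(hderiv x hx).deriv]
    have hs := hsin x hx
    have hc : 0 < Real.cos x := Real.cos_pos_of_mem_Ioo ⟨by linarith [hx.1, Real.pi_pos], hx.2⟩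
    have hsx : Real.sin x < x := Real.sin_lt hx.1
    have hsc := Real.sin_sq_add_cos_sq x
    have h1 : Real.cos x ≤ 1 := Real.cos_le_one x
    have h2 : Real.sin x ≤ 1 := Real.sin_le_one x
    rw [sub_nonpos, div_le_iff₀ (by positivity)]
    have h3 : 1 - Real.cos x ≤ Real.sin x ^ 2 := by nlinarith
    nlinarith [mul_le_mul_of_nonneg_right hsx.le hc.le, mul_le_mul_of_nonneg_left h3 hs.le,
      mul_le_mul_of_nonneg_right h2 (sq_nonneg (Real.sin x))]

/-- With `x = π/n` the constant is `(x / sin x - 2x) / m`, which decreases in `x`. -/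
theorem volume_constant_mono {n N : ℕ} (hn : 7 ≤ n) (hN : n ≤ N) {m : ℝ} (hm : 0 < m) :
    Real.pi * (1 - 2 * Real.sin (Real.pi / n)) / (m * n * Real.sin (Real.pi / n))
      ≤ Real.pi * (1 - 2 * Real.sin (Real.pi / N)) / (m * N * Real.sin (Real.pi / N)) := by
  have hpi := Real.pi_pos
  have key : ∀ k : ℕ, 7 ≤ k →
      Real.pi * (1 - 2 * Real.sin (Real.pi / k)) / (m * k * Real.sin (Real.pi / k))
        = (Real.pi / k / Real.sin (Real.pi / k) - 2 * (Real.pi / k)) / m := by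
    intro k hk
    have hs := (sin_pi_div_bounds hk).1
    have hk' : (0 : ℝ) < k := by exact_mod_cast (by omega : 0 < k)
    field_simp
  have hmem : ∀ k : ℕ, 7 ≤ k → Real.pi / k ∈ Set.Ioo 0 (Real.pi / 2) := by
    intro k hk
    have hk' : (7 : ℝ) ≤ k := by exact_mod_cast hk
    exact ⟨by positivity, div_lt_div_of_pos_left hpi (by norm_num) (by linarith)⟩
  rw [key n hn, key N (hn.trans hN)]
  refine div_le_div_of_nonneg_right ?_ hm.le
  refine antitoneOn_div_sin_sub (hmem N (hn.trans hN)) (hmem n hn) ?_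
  exact div_le_div_of_nonneg_left hpi.le (by exact_mod_cast (by omega : 0 < n))
    (by exact_mod_cast hN)

/-- The area of the quotient of a complex line is the area of a measurable set which is disjoint
from its translates. -/
theorem quotientVolume_line_eq (Γ : Subgroup PU21) [Countable Γ] (c : Fin 3 → ℂ) :
    ∃ D : Set (complexLine c), MeasurableSet D ∧
      quotientVolume (MulAction.stabilizer Γ (complexLine c)) (complexLine c) (lineArea c)
        = lineArea c D ∧
      ∀ γ ∈ Γ, γ • complexLine c = complexLine c →
        ∀ w ∈ (Subtype.val '' D : Set H2), γ • w ∈ (Subtype.val '' D : Set H2) →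
        ∀ z ∈ complexLine c, γ • z = z := by
  set μ := lineArea c
  let P := (MulAction.toPermHom (MulAction.stabilizer Γ (complexLine c)) (complexLine c)).range
  have hP : Countable P := (MonoidHom.rangeRestrict_surjective
    (MulAction.toPermHom (MulAction.stabilizer Γ (complexLine c)) (complexLine c))).countable
  by_cases hfd : HasFundamentalDomain P (complexLine c) μ
  swap
  -- Without a fundamental domain the covolume has the default value `0`, which is the area of the
  -- empty set.
  · refine ⟨∅, MeasurableSet.empty, ?_, ?_⟩
    · rw [measure_empty]
      exact dif_neg hfd
    · rintro γ - - w ⟨x, hx, -⟩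
      exact hx.elim
  have hvol : quotientVolume (MulAction.stabilizer Γ (complexLine c)) (complexLine c) μ
      = μ hfd.ExistsIsFundamentalDomain.choose := dif_pos hfd
  have hD := hfd.ExistsIsFundamentalDomain.choose_spec
  set D := hfd.ExistsIsFundamentalDomain.choose
  -- A fundamental domain is only null-measurable and disjoint from its translates up to null sets.
  -- Passing to a measurable subset and removing a measurable null set makes the disjointness exact.
  obtain ⟨D₀, hD₀D, hD₀, hae⟩ := hD.nullMeasurableSet.exists_measurable_subset_ae_eq
  set N : Set (complexLine c) := D₀ ∩ ⋃ σ : P, ⋃ (_ : σ ≠ 1), σ • D₀ with hN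
  have hNnull : μ N = 0 := by
    have h1 : ∀ σ : P, σ ≠ 1 → μ (D ∩ σ • D) = 0 := by
      intro σ hσ
      have := hD.aedisjoint (Ne.symm hσ)
      simpa [Function.onFun, AEDisjoint] using this
    rw [hN, Set.inter_iUnion]
    refine measure_iUnion_null fun σ => ?_
    rw [Set.inter_iUnion]
    refine measure_iUnion_null fun hσ => measure_mono_null ?_ (h1 σ hσ)
    exact Set.inter_subset_inter hD₀D (Set.smul_set_mono hD₀D)
  have hNm : μ (toMeasurable μ N) = 0 := by rw [measure_toMeasurable, hNnull]
  refine ⟨D₀ \ toMeasurable μ N, hD₀.diff (measurableSet_toMeasurable _ _), ?_, ?_⟩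
  · rw [hvol, measure_sdiff_null hNm, measure_congr hae]
  · rintro γ hγ hline _ ⟨w, hw, rfl⟩ ⟨v, hv, hvw⟩ z hz
    let h : MulAction.stabilizer Γ (complexLine c) := ⟨⟨γ, hγ⟩, hline⟩
    let σ : P := ⟨MulAction.toPermHom _ _ h, h, rfl⟩
    have hσw : σ • w = v := Subtype.ext hvw.symm
    by_cases hσ : σ = 1
    · have h1 : σ • (⟨z, hz⟩ : complexLine c) = ⟨z, hz⟩ := by rw [hσ, one_smul]
      exact congrArg Subtype.val h1
    · exfalso
      refine hv.2 (subset_toMeasurable _ _ ⟨hv.1, ?_⟩)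
      refine Set.mem_iUnion₂.2 ⟨σ, hσ, ?_⟩
      rw [← hσw]
      exact Set.smul_mem_smul_set hw.1

/-- A bound for the multiplicity of the tubes around the lines of an orbit yields a bound for the
volume of the quotient. -/
theorem volume_bound (Γ : Subgroup PU21) [DiscreteTopology Γ] {A : PU21} (hAΓ : A ∈ Γ)
    {c : Fin 3 → ℂ} (hA : IsComplexReflection A c) {n : ℕ} (hn : 7 ≤ n) (hAn : orderOf A = n)
    {m : ℕ} (hm : 0 < m)
    (hcount : ∀ (ζ : Circle) (S : ℝ) (B : Set H2), (ζ : ℂ) ≠ 1 → ‖(ζ : ℂ) - 1‖ < 1 →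
      ζ ∈ rotationGroup Γ c (herm_self_ne_zero hA.1) → ‖(ζ : ℂ) - 1‖ * (1 + 2 * S) ≤ 1 →
      (∀ γ ∈ Γ, γ • complexLine c = complexLine c → ∀ w ∈ B, γ • w ∈ B →
        ∀ z ∈ complexLine c, γ • z = z) →
      ∀ z, (returnSet Γ (tubeOver S c hA.1 B) z).encard
        ≤ ((m * Nat.card (rotationGroup Γ c (herm_self_ne_zero hA.1)) : ℕ) : ℕ∞)) :
    ENNReal.ofReal (Real.pi * (1 - 2 * Real.sin (Real.pi / n)) /
        (m * n * Real.sin (Real.pi / n))) *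
      quotientVolume (MulAction.stabilizer Γ (complexLine c)) (complexLine c) (lineArea c)
      ≤ quotientVolume Γ H2 hypVolume := by
  have hc := hA.1
  have hΓ := countable_of_discrete Γ
  have hG : Countable (permGroup Γ) :=
    (MonoidHom.rangeRestrict_surjective (MulAction.toPermHom Γ H2)).countable
  have := finite_rotationGroup Γ c (herm_self_ne_zero hc)
  set N := Nat.card (rotationGroup Γ c (herm_self_ne_zero hc)) with hNdef
  have hnN : n ≤ N := by
    rw [← hAn]
    exact orderOf_le_card_rotationGroup Γ hAΓ hA _
  have hN7 : 7 ≤ N := hn.trans hnN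
  have hrot : rotation N ∈ rotationGroup Γ c (herm_self_ne_zero hc) := rotation_mem_of_finite _
  have hnorm := norm_rotation_sub_one N (by omega)
  obtain ⟨hs0, hs1⟩ := sin_pi_div_bounds hN7
  set s := Real.sin (Real.pi / N) with hs
  -- The tube has `S = r - 1`. It satisfies the separation condition since `2s(1 + 2S) = 2s(2r - 1)
  -- ≤ 2s r² = 1`, and `(1 + S)² = 1/(2s)` produces the stated constant.
  set r := Real.sqrt (1 / (2 * s)) with hr
  have hr2 : r ^ 2 = 1 / (2 * s) := Real.sq_sqrt (by positivity)
  have hr1 : 1 ≤ r := by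
    rw [hr, Real.one_le_sqrt, le_div_iff₀ (by positivity)]
    linarith
  have hsr : 2 * s * r ^ 2 = 1 := by
    rw [hr2]
    field_simp
  obtain ⟨D, hD, hDvol, hDfree⟩ := quotientVolume_line_eq Γ c
  obtain ⟨F, hF⟩ := exists_isFundamentalDomain Γ
  have hFvol : quotientVolume Γ H2 hypVolume = hypVolume F := hF.covolume_eq_volume hypVolume
  have hB : MeasurableSet (Subtype.val '' D : Set H2) :=
    (MeasurableEmbedding.subtype_coe (isClosed_complexLine c).measurableSet).measurableSet_image.2 hD
  have hle := measure_le_of_encard_returnSet_le Γ hF (measurableSet_tubeOver hc (r - 1) hB)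
    (hcount (rotation N) (r - 1) _ (by
      intro h
      rw [h, sub_self, norm_zero] at hnorm
      linarith) (by rw [hnorm]; linarith) hrot (by
      rw [hnorm]
      nlinarith [mul_nonneg hs0.le (sq_nonneg (r - 1))]) hDfree)
  rw [hypVolume_tubeOver hc (by linarith) hD] at hle
  rw [hDvol, hFvol]
  have hm' : (0 : ℝ) < m := by exact_mod_cast hm
  have hN' : (0 : ℝ) < N := by exact_mod_cast (by omega : 0 < N)
  have hconst : 2 * Real.pi * ((1 + (r - 1)) ^ 2 - 1)
      = (m * N : ℕ) * (Real.pi * (1 - 2 * s) / (m * N * s)) := by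
    rw [add_sub_cancel, hr2]
    push_cast
    field_simp
  have hmN0 : ((m * N : ℕ) : ℝ≥0∞) ≠ 0 := by
    exact_mod_cast (Nat.mul_pos hm (by omega)).ne'
  rw [hconst, ENNReal.ofReal_mul (by positivity), ENNReal.ofReal_natCast, mul_assoc] at hle
  -- The factor `mN` cancels, being nonzero and finite, even when the area or the volume is
  -- infinite.
  have hle' := (ENNReal.mul_le_mul_iff_right hmN0 (ENNReal.natCast_ne_top _)).1 hle
  exact (mul_le_mul' (ENNReal.ofReal_le_ofReal (volume_constant_mono hn hnN hm')) le_rfl).trans hle'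

end ComplexHyperbolic

end

theorem mainTheorem7
    (Γ : Subgroup ComplexHyperbolic.PU21) (hΓ : DiscreteTopology Γ)
    (A : ComplexHyperbolic.PU21) (hAΓ : A ∈ Γ) (c : Fin 3 → ℂ)
    (hA : ComplexHyperbolic.IsComplexReflection A c)
    (n : ℕ) (hn : 7 ≤ n) (hAn : orderOf A = n) :
    ENNReal.ofReal (Real.pi * (1 - 2 * Real.sin (Real.pi / n)) /
          (2 * n * Real.sin (Real.pi / n))) *
        ComplexHyperbolic.quotientVolume
          (MulAction.stabilizer Γ (ComplexHyperbolic.complexLine c))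
          (ComplexHyperbolic.complexLine c) (ComplexHyperbolic.lineArea c)
      ≤ ComplexHyperbolic.quotientVolume Γ ComplexHyperbolic.H2 ComplexHyperbolic.hypVolume ∧
    ((¬ ∃ g ∈ Γ, ComplexHyperbolic.OrthogonalLines
        (g • ComplexHyperbolic.complexLine c) (ComplexHyperbolic.complexLine c)) →
      ENNReal.ofReal (Real.pi * (1 - 2 * Real.sin (Real.pi / n)) /
            (n * Real.sin (Real.pi / n))) *
          ComplexHyperbolic.quotientVolume
            (MulAction.stabilizer Γ (ComplexHyperbolic.complexLine c))
            (ComplexHyperbolic.complexLine c) (ComplexHyperbolic.lineArea c)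
        ≤ ComplexHyperbolic.quotientVolume Γ ComplexHyperbolic.H2
            ComplexHyperbolic.hypVolume) := by
  constructor
  · have h := ComplexHyperbolic.volume_bound Γ hAΓ hA hn hAn (m := 2) two_pos
      fun ζ S B h1 h2 h3 h4 h5 z =>
        ComplexHyperbolic.encard_returnSet_le Γ hA.1 h1 h2 h3 h4 h5 z
    simpa only [Nat.cast_ofNat] using h
  · intro hno
    have h := ComplexHyperbolic.volume_bound Γ hAΓ hA hn hAn (m := 1) one_pos
      fun ζ S B h1 h2 h3 h4 h5 z => by
        rw [one_mul]
        exact ComplexHyperbolic.encard_returnSet_le_of_not_orthogonal Γ hA.1 h1 h2 h3 h4 h5 hno z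
    simpa only [Nat.cast_one, one_mul] using h
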